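/- Let $\lambda_0 = 0.4912\ldots$ denote the unique positive real number satisfying $e^{-\lambda_0} = \lambda_0 + \lambda_0^2/2$. Assume the Riemann Hypothesis. Then there is a function $\delta(t)$ with $\delta(t) \to 0$ as $t \to \infty$ such that, for all sufficiently large real $t$, $$ |\zeta(\tfrac12 + it)| \le \exp\Big(\Big(\frac{1+\lambda_0}{4} + \delta(t)\Big)\frac{\log t}{\log\log t}\Big) \le \exp\Big(\frac38\,\frac{\log t}{\log\log t}\Big). $$ -/

import Mathlib

open Filter Topology

/-- There is exactly one positive real `l` with `e^{-l} = l + l^2/2`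
(and it lies between `0.4912` and `0.4913`). -/
theorem exists_lambdaZero :
    ∃ l : ℝ, (0 < l ∧ Real.exp (-l) = l + l ^ 2 / 2) ∧
      (∀ m : ℝ, 0 < m → Real.exp (-m) = m + m ^ 2 / 2 → m = l) ∧
      0.4912 < l ∧ l < 0.4913 := by
  have hc : ContinuousOn (fun x : ℝ => x + x ^ 2 / 2 - Real.exp (-x))
      (Set.Icc 0.4912 0.4913) := by fun_prop
  have ha : (0.4912 : ℝ) + 0.4912 ^ 2 / 2 - Real.exp (-0.4912) < 0 := by
    have h := Real.exp_bound (x := -0.4912) (by norm_num [abs_le]) (n := 8) (by norm_num)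
    norm_num [Finset.sum_range_succ, Nat.factorial, abs_le] at h ⊢
    linarith [h.1]
  have hb : 0 < (0.4913 : ℝ) + 0.4913 ^ 2 / 2 - Real.exp (-0.4913) := by
    have h := Real.exp_bound (x := -0.4913) (by norm_num [abs_le]) (n := 8) (by norm_num)
    norm_num [Finset.sum_range_succ, Nat.factorial, abs_le] at h ⊢
    linarith [h.2]
  obtain ⟨l, ⟨hl1, hl2⟩, hl⟩ := intermediate_value_Ioo (by norm_num) hc ⟨ha, hb⟩
  have hl : l + l ^ 2 / 2 - Real.exp (-l) = 0 := hl
  have hl0 : 0 < l := lt_trans (by norm_num) hl1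
  refine ⟨l, ⟨hl0, by linarith⟩, ?_, hl1, hl2⟩
  intro m hm hme
  rcases lt_trichotomy m l with h | h | h
  · have := Real.exp_lt_exp.2 (neg_lt_neg h)
    nlinarith
  · exact h
  · have := Real.exp_lt_exp.2 (neg_lt_neg h)
    nlinarith

/-- The constant `λ₀ = 0.4912…`: the unique positive real number with
`e^{-λ₀} = λ₀ + λ₀^2/2`. -/
noncomputable def lambdaZero : ℝ := Classical.choose exists_lambdaZero

/-- The defining properties of `lambdaZero`. -/
theorem lambdaZero_spec :
    (0 < lambdaZero ∧ Real.exp (-lambdaZero) = lambdaZero + lambdaZero ^ 2 / 2) ∧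
      (∀ m : ℝ, 0 < m → Real.exp (-m) = m + m ^ 2 / 2 → m = lambdaZero) ∧
      0.4912 < lambdaZero ∧ lambdaZero < 0.4913 :=
  Classical.choose_spec exists_lambdaZero

/-! Fix a small `d > 0`, put `T = log t`, `S = log T`, `s = 1/2 + d/S + it` and `Z(w) = (ζ'/ζ)(s +
w)`. Then `log |ζ(s)| = log |ζ(s + A)| - ∫₀ᴬ Re Z`, and `A = 1/2 + d` reaches the region of absolute
convergence, so an upper bound for `ζ` amounts to a lower bound for `∫₀ᴬ Re Z`.

The Riemann hypothesis enters through `re_logDeriv_xi_nonneg`: `Re ξ'/ξ ≥ 0` to the right of the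
critical line. No Hadamard product is used; Phragmén–Lindelöf applied to `ξ(1/2 + z - h) / ξ(1/2 + z
+ h)`, of modulus at most one on the imaginary axis, shows that `|ξ|` grows with the real part.
Removing the Gamma factor leaves `Re Z ≥ -L` with `L = T/2 + O(1)`.

The rest uses only this one-sided bound on a rectangle, tested against nonnegative kernels on its
left side. A difference of Poisson kernels gives Harnack's inequality `Re Z(u) ≥ (u/a) Re Z(a) - L(1
- u/a)` for `u ≤ a`; a kernel with a double pole gives `(Re Z)' + l Re Z ≥ -(e^{-ul}/a)(Re Z(a) +
L)` for `u ≥ a`, both up to errors. Integrate the first over `[0, a]` and the second over `[a, A]`,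
with `a = m/l`. The unknown `Re Z(a)` cancels exactly when `e^{-m} = m + m²/2`, that is `m = λ₀`,
and what remains is `∫₀ᴬ Re Z ≥ -(1 + λ₀)L/l - error` (`integral_re_ge_of_exp_eq`).

The error contains `e^{lX}` with `X` slightly above `1/2`, and it must be `o(T)`; this permits `l =
(2 - 10d)S`. Hence `log |ζ(s)|` is at most about `(1 + λ₀)T/(4S)`. Moving from `s` to the critical
line costs about `dT/(2S)`, and `d` is arbitrary. -/

section

open Set Complex MeasureTheory intervalIntegral

/-! ### Contour integrals over a rectangle -/

/-- The closed rectangle `[0, X] × [-Y, Y]`. -/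
def boxSet (X Y : ℝ) : Set ℂ := {w : ℂ | (0 ≤ w.re ∧ w.re ≤ X) ∧ -Y ≤ w.im ∧ w.im ≤ Y}

/-- The integral of `f` over the positively oriented boundary of `boxSet X Y`. -/
noncomputable def boxIntegral (f : ℂ → ℂ) (X Y : ℝ) : ℂ :=
  (∫ x : ℝ in (0 : ℝ)..X, f (x + (-Y : ℝ) * I)) - (∫ x : ℝ in (0 : ℝ)..X, f (x + Y * I)) +
    I • (∫ y : ℝ in (-Y)..Y, f (X + y * I)) - I • ∫ y : ℝ in (-Y)..Y, f (y * I)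

theorem boxIntegral_eq_zero {f : ℂ → ℂ} {X Y : ℝ} (hX : 0 ≤ X) (hY : 0 ≤ Y)
    (hf : DifferentiableOn ℂ f (boxSet X Y)) : boxIntegral f X Y = 0 := by
  have h := Complex.integral_boundary_rect_eq_zero_of_differentiableOn f ⟨0, -Y⟩ ⟨X, Y⟩ (by
    refine hf.mono fun w hw => ?_
    simp only [uIcc_of_le hX, uIcc_of_le (show -Y ≤ Y by linarith)] at hw
    exact hw)
  simpa [boxIntegral] using h

/-- Points of the boundary of the rectangle. -/
def boxFrontier (X Y : ℝ) : Set ℂ :=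
  {w : ℂ | w ∈ boxSet X Y ∧ (w.re = 0 ∨ w.re = X ∨ w.im = -Y ∨ w.im = Y)}

theorem boxFrontier_subset (X Y : ℝ) : boxFrontier X Y ⊆ boxSet X Y := fun _ h => h.1

theorem bottom_mem_boxFrontier {X Y x : ℝ} (hY : 0 ≤ Y) (hx : x ∈ Icc 0 X) :
    (x + (-Y : ℝ) * I : ℂ) ∈ boxFrontier X Y := by
  simp [boxFrontier, boxSet, hx.1, hx.2]; linarith

theorem top_mem_boxFrontier {X Y x : ℝ} (hY : 0 ≤ Y) (hx : x ∈ Icc 0 X) :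
    (x + Y * I : ℂ) ∈ boxFrontier X Y := by
  simp [boxFrontier, boxSet, hx.1, hx.2]; linarith

theorem right_mem_boxFrontier {X Y y : ℝ} (hX : 0 ≤ X) (hy : y ∈ Icc (-Y) Y) :
    (X + y * I : ℂ) ∈ boxFrontier X Y := by
  simp [boxFrontier, boxSet, hX, hy.1, hy.2]

theorem left_mem_boxFrontier {X Y y : ℝ} (hX : 0 ≤ X) (hy : y ∈ Icc (-Y) Y) :
    (y * I : ℂ) ∈ boxFrontier X Y := by
  simp [boxFrontier, boxSet, hX, hy.1, hy.2]

theorem intervalIntegrable_sides {f : ℂ → ℂ} {X Y : ℝ} (hX : 0 ≤ X) (hY : 0 ≤ Y)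
    (hf : ContinuousOn f (boxFrontier X Y)) :
    IntervalIntegrable (fun x : ℝ => f (x + (-Y : ℝ) * I)) volume 0 X ∧
    IntervalIntegrable (fun x : ℝ => f (x + Y * I)) volume 0 X ∧
    IntervalIntegrable (fun y : ℝ => f (X + y * I)) volume (-Y) Y ∧
    IntervalIntegrable (fun y : ℝ => f (y * I)) volume (-Y) Y := by
  have hY' : -Y ≤ Y := by linarith
  refine ⟨?_, ?_, ?_, ?_⟩
  · refine ContinuousOn.intervalIntegrable (hf.comp (by fun_prop) fun x hx => ?_)
    rw [uIcc_of_le hX] at hx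
    exact bottom_mem_boxFrontier hY hx
  · refine ContinuousOn.intervalIntegrable (hf.comp (by fun_prop) fun x hx => ?_)
    rw [uIcc_of_le hX] at hx
    exact top_mem_boxFrontier hY hx
  · refine ContinuousOn.intervalIntegrable (hf.comp (by fun_prop) fun x hx => ?_)
    rw [uIcc_of_le hY'] at hx
    exact right_mem_boxFrontier hX hx
  · refine ContinuousOn.intervalIntegrable (hf.comp (by fun_prop) fun x hx => ?_)
    rw [uIcc_of_le hY'] at hx
    exact left_mem_boxFrontier hX hx

theorem boxIntegral_congr {f g : ℂ → ℂ} {X Y : ℝ} (hX : 0 ≤ X) (hY : 0 ≤ Y)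
    (h : EqOn f g (boxFrontier X Y)) : boxIntegral f X Y = boxIntegral g X Y := by
  have hY' : -Y ≤ Y := by linarith
  unfold boxIntegral
  congr 1
  congr 1
  congr 1
  · refine integral_congr fun x hx => h ?_
    rw [uIcc_of_le hX] at hx
    exact bottom_mem_boxFrontier hY hx
  · refine integral_congr fun x hx => h ?_
    rw [uIcc_of_le hX] at hx
    exact top_mem_boxFrontier hY hx
  · congr 1
    refine integral_congr fun x hx => h ?_
    rw [uIcc_of_le hY'] at hx
    exact right_mem_boxFrontier hX hx
  · congr 1
    refine integral_congr fun x hx => h ?_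
    rw [uIcc_of_le hY'] at hx
    exact left_mem_boxFrontier hX hx

theorem boxIntegral_add {f g : ℂ → ℂ} {X Y : ℝ} (hX : 0 ≤ X) (hY : 0 ≤ Y)
    (hf : ContinuousOn f (boxFrontier X Y)) (hg : ContinuousOn g (boxFrontier X Y)) :
    boxIntegral (fun w => f w + g w) X Y = boxIntegral f X Y + boxIntegral g X Y := by
  obtain ⟨f1, f2, f3, f4⟩ := intervalIntegrable_sides hX hY hf
  obtain ⟨g1, g2, g3, g4⟩ := intervalIntegrable_sides hX hY hg
  simp only [boxIntegral]
  rw [integral_add f1 g1, integral_add f2 g2, integral_add f3 g3, integral_add f4 g4]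
  simp only [smul_eq_mul]
  ring

theorem boxIntegral_const_mul (c : ℂ) (f : ℂ → ℂ) (X Y : ℝ) :
    boxIntegral (fun w => c * f w) X Y = c * boxIntegral f X Y := by
  simp only [boxIntegral, intervalIntegral.integral_const_mul, smul_eq_mul]
  ring

theorem sub_ne_zero_of_mem_boxFrontier {X Y u : ℝ} (hY : 0 < Y) (hu : 0 < u) (huX : u < X) {w : ℂ}
    (hw : w ∈ boxFrontier X Y) : w - u ≠ 0 := by
  intro h
  have h1 : w = u := sub_eq_zero.1 h
  subst h1
  obtain ⟨-, h | h | h | h⟩ := hw <;> simp at h <;> linarith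

/-- Integration of a derivative along a horizontal or vertical segment `c + r * d`. -/
theorem integral_segment_eq_sub {F f : ℂ → ℂ} {c d : ℂ} {p q : ℝ}
    (hF : ∀ r ∈ uIcc p q, HasDerivAt F (f (c + r * d)) (c + r * d))
    (hf : ContinuousOn (fun r : ℝ => f (c + r * d)) (uIcc p q)) :
    d * ∫ r in p..q, f (c + r * d) = F (c + q * d) - F (c + p * d) := by
  rw [← intervalIntegral.integral_const_mul]
  refine integral_eq_sub_of_hasDerivAt (f := fun r : ℝ => F (c + r * d)) (fun r hr => ?_)
    ((continuousOn_const.mul hf).intervalIntegrable)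
  have h1 : HasDerivAt (fun r : ℝ => c + (r : ℂ) * d) d r := by
    simpa using ((hasDerivAt_id r).ofReal_comp.mul_const d).const_add c
  have := (hF r hr).comp r h1
  rwa [mul_comm] at this

theorem boxIntegral_inv_sub_sq {X Y u : ℝ} (hY : 0 < Y) (hu : 0 < u) (huX : u < X) :
    boxIntegral (fun w => 1 / (w - u) ^ 2) X Y = 0 := by
  have hX : 0 ≤ X := (hu.trans huX).le
  have hY' : -Y ≤ Y := by linarith
  have hd : ∀ w ∈ boxFrontier X Y, HasDerivAt (fun w : ℂ => -(w - u)⁻¹) (1 / (w - u) ^ 2) w := by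
    intro w hw
    have h0 := sub_ne_zero_of_mem_boxFrontier hY hu huX hw
    have := (((hasDerivAt_id w).sub_const (u : ℂ)).inv h0).neg
    refine this.congr_deriv ?_
    simp [neg_div]
  have hc : ContinuousOn (fun w : ℂ => 1 / (w - u) ^ 2) (boxFrontier X Y) :=
    continuousOn_const.div (by fun_prop) fun w hw =>
      pow_ne_zero 2 (sub_ne_zero_of_mem_boxFrontier hY hu huX hw)
  have key : ∀ (c d : ℂ) (p q : ℝ), (∀ r ∈ uIcc p q, c + r * d ∈ boxFrontier X Y) →
      d * ∫ r in p..q, 1 / (c + r * d - u) ^ 2 = -(c + q * d - u)⁻¹ - -(c + p * d - u)⁻¹ := by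
    intro c d p q h
    exact integral_segment_eq_sub (F := fun w : ℂ => -(w - u)⁻¹) (f := fun w => 1 / (w - u) ^ 2)
      (fun r hr => hd _ (h r hr)) (hc.comp (by fun_prop) fun r hr => h r hr)
  have k1 := key ((-Y : ℝ) * I) 1 0 X fun r hr => by
    rw [uIcc_of_le hX] at hr; simpa [add_comm] using bottom_mem_boxFrontier hY.le hr
  have k2 := key (Y * I) 1 0 X fun r hr => by
    rw [uIcc_of_le hX] at hr; simpa [add_comm] using top_mem_boxFrontier hY.le hr
  have k3 := key X I (-Y) Y fun r hr => by
    rw [uIcc_of_le hY'] at hr; exact right_mem_boxFrontier hX hr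
  have k4 := key 0 I (-Y) Y fun r hr => by
    rw [uIcc_of_le hY'] at hr; simpa using left_mem_boxFrontier hX hr
  simp only [mul_one, one_mul, zero_add, add_comm ((-Y : ℝ) * I : ℂ), add_comm (Y * I : ℂ)]
    at k1 k2 k3 k4
  rw [boxIntegral, smul_eq_mul, smul_eq_mul, k1, k2, k3, k4]
  push_cast
  ring

theorem boxIntegral_inv_sub {X Y u : ℝ} (hY : 0 < Y) (hu : 0 < u) (huX : u < X) :
    boxIntegral (fun w => 1 / (w - u)) X Y = 2 * Real.pi * I := by
  have hX : 0 ≤ X := (hu.trans huX).le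
  have hY' : -Y ≤ Y := by linarith
  have hc : ContinuousOn (fun w : ℂ => 1 / (w - u)) (boxFrontier X Y) :=
    continuousOn_const.div (by fun_prop) fun w hw =>
      (sub_ne_zero_of_mem_boxFrontier hY hu huX hw)
  -- The factor `e` rotates each side into the right half-plane, where the principal logarithm has
  -- no jump. The rotated logarithms are compared at the corners by `hI` and `hI'`; the quarter
  -- turns add up to `2πi`.
  have key : ∀ (e c d : ℂ) (p q : ℝ), e ≠ 0 → (∀ r ∈ uIcc p q, c + r * d ∈ boxFrontier X Y) →
      (∀ r ∈ uIcc p q, e * (c + r * d - u) ∈ slitPlane) →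
      d * ∫ r in p..q, 1 / (c + r * d - u) =
        log (e * (c + q * d - u)) - log (e * (c + p * d - u)) := by
    intro e c d p q he h h'
    refine integral_segment_eq_sub (F := fun w : ℂ => log (e * (w - u))) (f := fun w => 1 / (w - u))
      (fun r hr => ?_) (hc.comp (by fun_prop) fun r hr => h r hr)
    have h0 := sub_ne_zero_of_mem_boxFrontier hY hu huX (h r hr)
    have := (((hasDerivAt_id (c + r * d)).sub_const (u : ℂ)).const_mul e).clog (h' r hr)
    refine this.congr_deriv ?_
    simp only [id]
    field_simp
  have k1 := key I ((-Y : ℝ) * I) 1 0 X I_ne_zero (fun r hr => by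
    rw [uIcc_of_le hX] at hr; simpa [add_comm] using bottom_mem_boxFrontier hY.le hr)
    fun r hr => Or.inl (by simp [hY])
  have k2 := key (-I) (Y * I) 1 0 X (by simp) (fun r hr => by
    rw [uIcc_of_le hX] at hr; simpa [add_comm] using top_mem_boxFrontier hY.le hr)
    fun r hr => Or.inl (by simp [hY])
  have k3 := key 1 X I (-Y) Y one_ne_zero (fun r hr => by
    rw [uIcc_of_le hY'] at hr; exact right_mem_boxFrontier hX hr)
    fun r hr => Or.inl (by simp [huX])
  have k4 := key (-1) 0 I (-Y) Y (by simp) (fun r hr => by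
    rw [uIcc_of_le hY'] at hr; simpa using left_mem_boxFrontier hX hr)
    fun r hr => Or.inl (by simp [hu])
  simp only [mul_one, one_mul, zero_add, add_comm ((-Y : ℝ) * I : ℂ), add_comm (Y * I : ℂ)]
    at k1 k2 k3 k4
  rw [boxIntegral, smul_eq_mul, smul_eq_mul, k1, k2, k3, k4]
  have hI : ∀ z : ℂ, 0 < z.re → log (I * z) = log z + Real.pi / 2 * I := by
    intro z h1
    have hz : z ≠ 0 := by rintro rfl; simp at h1
    have ha := abs_lt.1 (abs_arg_lt_pi_div_two_iff.2 (Or.inl h1))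
    rw [log_mul I_ne_zero hz, log_I]
    · ring
    · rw [arg_I]; constructor <;> linarith [Real.pi_pos]
  have hI' : ∀ z : ℂ, 0 < z.re → log (-I * z) = log z - Real.pi / 2 * I := by
    intro z h1
    have hz : z ≠ 0 := by rintro rfl; simp at h1
    have ha := abs_lt.1 (abs_arg_lt_pi_div_two_iff.2 (Or.inl h1))
    rw [log_mul (by simp) hz, log_neg_I]
    · ring
    · rw [arg_neg_I]; constructor <;> linarith [Real.pi_pos]
  rw [hI (X + (-Y : ℝ) * I - u) (by simp [huX]), hI' (X + Y * I - u) (by simp [huX]),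
    show I * ((0 : ℝ) + (-Y : ℝ) * I - u : ℂ) = -I * (u + Y * I) by push_cast; ring,
    show -I * ((0 : ℝ) + Y * I - u : ℂ) = I * (u - Y * I) by push_cast; ring,
    hI' (u + Y * I) (by simp [hu]), hI (u - Y * I) (by simp [hu]),
    show (-1 * (Y * I - u) : ℂ) = u - Y * I by ring,
    show (-1 * ((-Y : ℝ) * I - u) : ℂ) = u + Y * I by push_cast; ring]
  ring

/-- Cauchy's integral formula for a rectangle. -/
theorem boxIntegral_div_sub {f : ℂ → ℂ} {U : Set ℂ} {X Y u : ℝ} (hY : 0 < Y) (hu : 0 < u)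
    (huX : u < X) (hU : IsOpen U) (hUbox : boxSet X Y ⊆ U) (hf : DifferentiableOn ℂ f U) :
    boxIntegral (fun w => f w / (w - u)) X Y = 2 * Real.pi * I * f u := by
  have hX : 0 ≤ X := (hu.trans huX).le
  have huU : (u : ℂ) ∈ U := hUbox (by simp [boxSet, hu.le, huX.le, hY.le])
  -- The divided difference is holomorphic across `u`, so only the term `f u / (w - u)` contributes.
  have hD : DifferentiableOn ℂ (dslope f u) U :=
    (differentiableOn_dslope (hU.mem_nhds huU)).2 hf
  have hne := fun w => sub_ne_zero_of_mem_boxFrontier (w := w) hY hu huX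
  have hsub := (boxFrontier_subset X Y).trans hUbox
  have hc : ContinuousOn (fun w : ℂ => 1 / (w - u)) (boxFrontier X Y) :=
    continuousOn_const.div (by fun_prop) hne
  rw [boxIntegral_congr hX hY.le (g := fun w => dslope f u w + f u * (1 / (w - u))),
    boxIntegral_add (f := dslope f u) (g := fun w => f u * (1 / (w - u))) hX hY.le
      (hD.continuousOn.mono hsub) (continuousOn_const.mul hc),
    boxIntegral_eq_zero hX hY.le (hD.mono hUbox), boxIntegral_const_mul,
    boxIntegral_inv_sub hY hu huX]
  · ring
  · intro w hw
    have := hne w hw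
    simp only [dslope_of_ne f (sub_ne_zero.1 this), slope, vsub_eq_sub, smul_eq_mul]
    field_simp
    ring

/-- Cauchy's integral formula for the derivative, on a rectangle. -/
theorem boxIntegral_div_sub_sq {f : ℂ → ℂ} {U : Set ℂ} {X Y u : ℝ} (hY : 0 < Y) (hu : 0 < u)
    (huX : u < X) (hU : IsOpen U) (hUbox : boxSet X Y ⊆ U) (hf : DifferentiableOn ℂ f U) :
    boxIntegral (fun w => f w / (w - u) ^ 2) X Y = 2 * Real.pi * I * deriv f u := by
  have hX : 0 ≤ X := (hu.trans huX).le
  have huU : (u : ℂ) ∈ U := hUbox (by simp [boxSet, hu.le, huX.le, hY.le])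
  have hD : DifferentiableOn ℂ (dslope f u) U :=
    (differentiableOn_dslope (hU.mem_nhds huU)).2 hf
  have hne := fun w => sub_ne_zero_of_mem_boxFrontier (w := w) hY hu huX
  have hsub := (boxFrontier_subset X Y).trans hUbox
  have hc : ContinuousOn (fun w : ℂ => 1 / (w - u) ^ 2) (boxFrontier X Y) :=
    continuousOn_const.div (by fun_prop) fun w hw => pow_ne_zero 2 (hne w hw)
  rw [boxIntegral_congr hX hY.le (g := fun w => dslope f u w / (w - u) + f u * (1 / (w - u) ^ 2)),
    boxIntegral_add (f := fun w => dslope f u w / (w - u)) (g := fun w => f u * (1 / (w - u) ^ 2))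
      hX hY.le ((hD.continuousOn.mono hsub).div (by fun_prop) hne) (continuousOn_const.mul hc),
    boxIntegral_div_sub hY hu huX hU hUbox hD, boxIntegral_const_mul,
    boxIntegral_inv_sub_sq hY hu huX, dslope_same]
  · ring
  · intro w hw
    have := hne w hw
    simp only [dslope_of_ne f (sub_ne_zero.1 this), slope, vsub_eq_sub, smul_eq_mul]
    field_simp
    ring

/-! ### One-sided bounds on a rectangle: Poisson, Harnack and a differential inequality -/

theorem integral_inv_sq_add_sq_eq {d Y : ℝ} (hd : 0 < d) :
    ∫ y in (-Y)..Y, 1 / (d ^ 2 + y ^ 2) = 2 * Real.arctan (Y / d) / d := by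
  have h : ∀ y ∈ uIcc (-Y) Y, HasDerivAt (fun y => Real.arctan (y / d) / d)
      (1 / (d ^ 2 + y ^ 2)) y := by
    intro y _
    have := (((hasDerivAt_id y).div_const d).arctan).div_const d
    refine this.congr_deriv ?_
    have : 0 < d ^ 2 + y ^ 2 := by positivity
    simp only [id]
    field_simp
  rw [integral_eq_sub_of_hasDerivAt h]
  · rw [neg_div, Real.arctan_neg]; ring
  · refine Continuous.intervalIntegrable ?_ _ _
    exact continuous_const.div (by fun_prop) fun y => by positivity

theorem integral_inv_sq_add_sq_le {d Y : ℝ} (hd : 0 < d) :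
    ∫ y in (-Y)..Y, 1 / (d ^ 2 + y ^ 2) ≤ Real.pi / d := by
  rw [integral_inv_sq_add_sq_eq hd]
  gcongr
  linarith [Real.arctan_lt_pi_div_two (Y / d)]

theorem continuous_inv_sq_add_sq {d : ℝ} (hd : 0 < d) :
    Continuous fun y : ℝ => 1 / (d ^ 2 + y ^ 2) :=
  continuous_const.div (by fun_prop) fun y => by positivity

/-- If the boundary integral of `g` is `2πi r`, the integral of `g` along the left side is `-2πr` up
to the contribution of the three other sides. -/
theorem norm_integral_left_add_le {g : ℂ → ℂ} {X Y A m b : ℝ} {r : ℂ} (hX : 0 ≤ X) (hY : 0 < Y)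
    (hA : A < X) (hg : boxIntegral g X Y = 2 * Real.pi * I * r)
    (hh : ∀ w ∈ boxSet X Y, |w.im| = Y → ‖g w‖ ≤ m)
    (hr : ∀ y ∈ Icc (-Y) Y, ‖g (X + y * I)‖ ≤ b * (1 / ((X - A) ^ 2 + y ^ 2))) (hb : 0 ≤ b) :
    ‖(∫ y : ℝ in (-Y)..Y, g (y * I)) + 2 * Real.pi * r‖ ≤ 2 * X * m + b * (Real.pi / (X - A)) := by
  have hY' : -Y ≤ Y := by linarith
  have h1 : ‖∫ x : ℝ in (0 : ℝ)..X, g (x + (-Y : ℝ) * I)‖ ≤ m * |X - 0| := by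
    refine norm_integral_le_of_norm_le_const fun x hx => hh _ ?_ ?_
    · rw [uIoc_of_le hX] at hx
      exact (bottom_mem_boxFrontier hY.le ⟨hx.1.le, hx.2⟩).1
    · simp [abs_of_pos hY]
  have h2 : ‖∫ x : ℝ in (0 : ℝ)..X, g (x + Y * I)‖ ≤ m * |X - 0| := by
    refine norm_integral_le_of_norm_le_const fun x hx => hh _ ?_ ?_
    · rw [uIoc_of_le hX] at hx
      exact (top_mem_boxFrontier hY.le ⟨hx.1.le, hx.2⟩).1
    · simp [abs_of_pos hY]
  have h3 : ‖∫ y : ℝ in (-Y)..Y, g (X + y * I)‖ ≤ b * (Real.pi / (X - A)) := by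
    refine (norm_integral_le_of_norm_le hY' (g := fun y => b * (1 / ((X - A) ^ 2 + y ^ 2)))
      (ae_of_all _ fun y hy => hr y ⟨hy.1.le, hy.2⟩) ?_).trans ?_
    · exact (continuous_const.mul (continuous_inv_sq_add_sq (sub_pos.2 hA))).intervalIntegrable _ _
    · rw [intervalIntegral.integral_const_mul]
      exact mul_le_mul_of_nonneg_left (integral_inv_sq_add_sq_le (sub_pos.2 hA)) hb
  rw [sub_zero, abs_of_nonneg hX] at h1 h2
  have e : (∫ y : ℝ in (-Y)..Y, g (y * I)) + 2 * Real.pi * r =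
      -I * (∫ x : ℝ in (0 : ℝ)..X, g (x + (-Y : ℝ) * I)) +
      I * (∫ x : ℝ in (0 : ℝ)..X, g (x + Y * I)) + ∫ y : ℝ in (-Y)..Y, g (X + y * I) := by
    simp only [boxIntegral, smul_eq_mul] at hg
    linear_combination I * hg + (2 * Real.pi * r + (∫ y : ℝ in (-Y)..Y, g (y * I)) -
      ∫ y : ℝ in (-Y)..Y, g (X + y * I)) * I_sq
  rw [e]
  refine (norm_add₃_le).trans ?_
  rw [norm_mul, norm_mul, norm_neg, norm_I]
  linarith

/-- A holomorphic function on `boxSet X Y` whose real part is at least `-L`, with bounds `M` on the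
horizontal sides and `B` to the right of `re w = A`. -/
structure BoxBounds (Z : ℂ → ℂ) (U : Set ℂ) (X Y A L M B : ℝ) : Prop where
  isOpen : IsOpen U
  subset : boxSet X Y ⊆ U
  diff : DifferentiableOn ℂ Z U
  A_pos : 0 < A
  A_lt : A < X
  Y_ge : 1 ≤ Y
  L_nonneg : 0 ≤ L
  M_nonneg : 0 ≤ M
  B_nonneg : 0 ≤ B
  norm_le_M : ∀ w ∈ boxSet X Y, |w.im| = Y → ‖Z w‖ ≤ M
  norm_le_B : ∀ w ∈ boxSet X Y, A ≤ w.re → ‖Z w‖ ≤ B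
  neg_L_le : ∀ w ∈ boxSet X Y, -L ≤ (Z w).re

/-- The contribution of three sides of the box to a contour integral of `Z`. -/
noncomputable def sideError (X Y A M B : ℝ) : ℝ := 2 * X * (M / Y ^ 2) + B * (Real.pi / (X - A))

/-- Kernels with a factor at the mirror point `-u`, which lies outside the box, can thus be bounded
by powers of `‖w - u‖` alone. -/
theorem norm_sub_sq_le_norm_add_sq {w : ℂ} {u : ℝ} (hw : 0 ≤ w.re) (hu : 0 ≤ u) :
    ‖w - u‖ ^ 2 ≤ ‖w + u‖ ^ 2 := by
  rw [Complex.sq_norm, Complex.sq_norm, normSq_apply, normSq_apply]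
  simp
  nlinarith [mul_nonneg hw hu]

namespace BoxBounds

variable {Z : ℂ → ℂ} {U : Set ℂ} {X Y A L M B : ℝ}

theorem X_pos (h : BoxBounds Z U X Y A L M B) : 0 < X := h.A_pos.trans h.A_lt

theorem Y_pos (h : BoxBounds Z U X Y A L M B) : 0 < Y := by linarith [h.Y_ge]

theorem sideError_nonneg (h : BoxBounds Z U X Y A L M B) : 0 ≤ sideError X Y A M B := by
  have h1 := h.X_pos
  have h2 := sub_pos.2 h.A_lt
  have h3 := h.M_nonneg
  have h4 := h.B_nonneg
  have h5 := Real.pi_pos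
  unfold sideError
  positivity

theorem ofReal_mem (h : BoxBounds Z U X Y A L M B) {u : ℝ} (hu : u ∈ Icc 0 X) :
    (u : ℂ) ∈ boxSet X Y := by
  simp [boxSet, hu.1, hu.2, h.Y_pos.le]

theorem left_mem (h : BoxBounds Z U X Y A L M B) {y : ℝ} (hy : y ∈ Icc (-Y) Y) :
    (y * I : ℂ) ∈ boxSet X Y := (left_mem_boxFrontier h.X_pos.le hy).1

theorem continuousOn_left (h : BoxBounds Z U X Y A L M B) :
    ContinuousOn (fun y : ℝ => Z (y * I)) (uIcc (-Y) Y) := by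
  rw [uIcc_of_le (by linarith [h.Y_pos])]
  exact h.diff.continuousOn.comp (by fun_prop) fun y hy => h.subset (h.left_mem hy)

/-- Since `u ≤ A < X`, the squared distance to `u` is at least `Y ^ 2` on the horizontal sides and
`(X - A) ^ 2 + y ^ 2` on the right side. Quadratic decay of `g` therefore leaves only `sideError`.
-/
theorem norm_left_add_le (h : BoxBounds Z U X Y A L M B) {g : ℂ → ℂ} {r : ℂ} {c u : ℝ}
    (hg : boxIntegral g X Y = 2 * Real.pi * I * r) (hc : 0 ≤ c) (hu : u ≤ A)
    (hb : ∀ w ∈ boxSet X Y, w - u ≠ 0 → ‖g w‖ ≤ c * ‖Z w‖ / ‖w - u‖ ^ 2) :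
    ‖(∫ y : ℝ in (-Y)..Y, g (y * I)) + 2 * Real.pi * r‖ ≤ c * sideError X Y A M B := by
  have hY := h.Y_pos
  have hX := h.X_pos
  refine (norm_integral_left_add_le (m := c * M / Y ^ 2) (b := c * B) hX.le hY h.A_lt hg
    (fun w hw him => ?_) (fun y hy => ?_) (mul_nonneg hc h.B_nonneg)).trans_eq ?_
  · have h1 := h.norm_le_M w hw him
    have h2 : Y ≤ ‖w - u‖ := by
      have := abs_im_le_norm (w - u)
      simpa [him] using this
    refine (hb w hw (norm_pos_iff.1 (hY.trans_le h2))).trans ?_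
    gcongr
    exact mul_nonneg hc h.M_nonneg
  · have hw := (right_mem_boxFrontier hX.le hy).1
    have h1 := h.norm_le_B _ hw (by simp [h.A_lt.le])
    have h2 : (X - A) ^ 2 + y ^ 2 ≤ ‖(X + y * I : ℂ) - u‖ ^ 2 := by
      rw [Complex.sq_norm, normSq_apply]
      have := h.A_lt
      simp
      nlinarith
    have h3 : 0 < (X - A) ^ 2 + y ^ 2 := by
      have := sub_pos.2 h.A_lt
      positivity
    have h4 : ‖(X + y * I : ℂ) - u‖ ≠ 0 := fun h0 => by
      rw [h0] at h2
      linarith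
    refine (hb _ hw (norm_ne_zero_iff.1 h4)).trans ?_
    rw [mul_one_div]
    gcongr
    exact mul_nonneg hc h.B_nonneg
  · unfold sideError
    ring

/-- The Poisson formula for the left side of the box. -/
theorem norm_poisson_sub_le (h : BoxBounds Z U X Y A L M B) {u : ℝ} (hu : 0 < u) (huA : u ≤ A) :
    ‖(∫ y : ℝ in (-Y)..Y, (u * (1 / (u ^ 2 + y ^ 2)) : ℝ) * Z (y * I)) - Real.pi * Z u‖ ≤
      u * sideError X Y A M B := by
  have hu0 : (u : ℂ) ≠ 0 := ofReal_ne_zero.2 hu.ne'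
  have hadd : ∀ w ∈ boxSet X Y, w + u ≠ 0 := by
    intro w hw h0
    have := congrArg re h0
    simp at this
    linarith [hw.1.1]
  have hV : IsOpen (U ∩ {w : ℂ | w + u ≠ 0}) :=
    h.isOpen.inter (isOpen_ne_fun (by fun_prop) (by fun_prop))
  -- The factor `1 / (w + u)` turns the Cauchy kernel into `-u / ((w - u)(w + u))`: on `w = iy` this
  -- is the Poisson kernel, and elsewhere it decays quadratically. Its residue at `u` is `-Z u / 2`.
  have hbox := boxIntegral_div_sub (f := fun w => -u * Z w / (w + u)) (u := u) h.Y_pos hu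
    (huA.trans_lt h.A_lt) hV (fun w hw => ⟨h.subset hw, hadd w hw⟩)
    (((h.diff.mono inter_subset_left).const_mul _).div (by fun_prop) fun w hw => hw.2)
  refine le_of_eq_of_le ?_ (h.norm_left_add_le (u := u) hbox hu.le huA fun w hw h0 => ?_)
  · congr 1
    rw [sub_eq_add_neg]
    congr 1
    · refine integral_congr fun y _ => ?_
      have h1 : ((u ^ 2 + y ^ 2 : ℝ) : ℂ) ≠ 0 := ofReal_ne_zero.2 (by positivity)
      have e : ((u ^ 2 + y ^ 2 : ℝ) : ℂ) = -((y * I + u) * (y * I - u)) := by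
        push_cast
        linear_combination y ^ 2 * I_sq
      have h2 : (y * I + u : ℂ) ≠ 0 := by rintro h0; simp [e, h0] at h1
      have h3 : (y * I - u : ℂ) ≠ 0 := by rintro h0; simp [e, h0] at h1
      rw [ofReal_mul, ofReal_div, e]
      push_cast
      field_simp
    · field_simp
      ring
  · have h1 := norm_sub_sq_le_norm_add_sq hw.1.1 hu.le
    have h2 : ‖w - u‖ ≤ ‖w + u‖ := by
      exact (sq_le_sq₀ (norm_nonneg _) (norm_nonneg _)).1 h1
    rw [norm_div, norm_div, norm_mul, norm_neg, norm_real, Real.norm_of_nonneg hu.le, div_div]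
    have h3 : 0 < ‖w - u‖ := norm_pos_iff.2 h0
    rw [sq]
    gcongr

theorem integral_re_ge (h : BoxBounds Z U X Y A L M B) {k : ℝ → ℝ} (hk : Continuous k)
    (hk0 : ∀ y, 0 ≤ k y) :
    -L * ∫ y in (-Y)..Y, k y ≤ (∫ y : ℝ in (-Y)..Y, (k y : ℂ) * Z (y * I)).re := by
  have hY : -Y ≤ Y := by linarith [h.Y_pos]
  have hc : ContinuousOn (fun y : ℝ => (k y : ℂ) * Z (y * I)) (uIcc (-Y) Y) :=
    (continuous_ofReal.comp hk).continuousOn.mul h.continuousOn_left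
  have e : (∫ y : ℝ in (-Y)..Y, (k y : ℂ) * Z (y * I)).re =
      ∫ y : ℝ in (-Y)..Y, ((k y : ℂ) * Z (y * I)).re :=
    (reCLM.intervalIntegral_comp_comm hc.intervalIntegrable).symm
  rw [e, ← intervalIntegral.integral_const_mul]
  refine integral_mono_on hY ?_ ?_ fun y hy => ?_
  · exact (continuous_const.mul hk).intervalIntegrable _ _
  · exact (continuous_re.comp_continuousOn hc).intervalIntegrable
  · rw [re_ofReal_mul, mul_comm]
    exact mul_le_mul_of_nonneg_left (h.neg_L_le _ (h.left_mem hy)) (hk0 y)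

/-- Harnack's inequality on the real axis. -/
theorem harnack (h : BoxBounds Z U X Y A L M B) {u a : ℝ} (hu : 0 < u) (hua : u ≤ a)
    (haA : a ≤ A) :
    u / a * (Z a).re - L * (1 - u / a) - u * (L + 2 * sideError X Y A M B) ≤ (Z u).re := by
  have ha : 0 < a := hu.trans_le hua
  have hE := h.sideError_nonneg
  have hY := h.Y_pos
  have P1 := h.norm_poisson_sub_le hu (hua.trans haA)
  have P2 := h.norm_poisson_sub_le ha haA
  -- For `u ≤ a` this difference of Poisson kernels is nonnegative, of total mass about `π(1 -
  -- u/a)`. Testing `Re Z ≥ -L` against it is Harnack's inequality.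
  have hk0 : ∀ y : ℝ, 0 ≤ u * (1 / (u ^ 2 + y ^ 2)) - u / a * (a * (1 / (a ^ 2 + y ^ 2))) := by
    intro y
    have : u / a * (a * (1 / (a ^ 2 + y ^ 2))) = u * (1 / (a ^ 2 + y ^ 2)) := by field_simp
    rw [this, sub_nonneg]
    gcongr
  have c1 := (continuous_inv_sq_add_sq hu)
  have c2 := (continuous_inv_sq_add_sq ha)
  have K := h.integral_re_ge (by fun_prop) hk0
  have hint : ∀ {d : ℝ}, 0 < d → IntervalIntegrable
      (fun y : ℝ => ((d * (1 / (d ^ 2 + y ^ 2)) : ℝ) : ℂ) * Z (y * I)) volume (-Y) Y := fun hd =>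
    ((continuous_ofReal.comp (continuous_const.mul
      (continuous_inv_sq_add_sq hd))).continuousOn.mul h.continuousOn_left).intervalIntegrable
  have e : (∫ y : ℝ in (-Y)..Y, ((u * (1 / (u ^ 2 + y ^ 2)) -
      u / a * (a * (1 / (a ^ 2 + y ^ 2))) : ℝ) : ℂ) * Z (y * I)) =
      (∫ y : ℝ in (-Y)..Y, (u * (1 / (u ^ 2 + y ^ 2)) : ℝ) * Z (y * I)) -
      (u / a : ℝ) * (∫ y : ℝ in (-Y)..Y, (a * (1 / (a ^ 2 + y ^ 2)) : ℝ) * Z (y * I)) := by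
    rw [← intervalIntegral.integral_const_mul,
      ← intervalIntegral.integral_sub (hint hu) ((hint ha).const_mul _)]
    refine integral_congr fun y _ => ?_
    push_cast
    ring
  rw [e] at K
  have eK : ∫ y in (-Y)..Y, (u * (1 / (u ^ 2 + y ^ 2)) - u / a * (a * (1 / (a ^ 2 + y ^ 2)))) =
      2 * Real.arctan (Y / u) - u / a * (2 * Real.arctan (Y / a)) := by
    rw [intervalIntegral.integral_sub,
      intervalIntegral.integral_const_mul, intervalIntegral.integral_const_mul,
      intervalIntegral.integral_const_mul, integral_inv_sq_add_sq_eq hu,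
      integral_inv_sq_add_sq_eq ha]
    · field_simp
    · exact (continuous_const.mul c1).intervalIntegrable _ _
    · exact (continuous_const.mul (continuous_const.mul c2)).intervalIntegrable _ _
  rw [eK, sub_re, re_ofReal_mul] at K
  set I1 := ∫ y : ℝ in (-Y)..Y, (u * (1 / (u ^ 2 + y ^ 2)) : ℝ) * Z (y * I)
  set I2 := ∫ y : ℝ in (-Y)..Y, (a * (1 / (a ^ 2 + y ^ 2)) : ℝ) * Z (y * I)
  set E := sideError X Y A M B
  have Q1 := abs_le.1 ((abs_re_le_norm _).trans P1)
  have Q2 := abs_le.1 ((abs_re_le_norm _).trans P2)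
  rw [sub_re, re_ofReal_mul] at Q1 Q2
  have t1 : Real.arctan (Y / u) ≤ Real.pi / 2 := (Real.arctan_lt_pi_div_two _).le
  -- Truncating the kernel at height `Y ≥ 1` loses at most `arctan (a / Y) ≤ a`; after the factor `u
  -- / a` the loss is of order `u`.
  have t2 : Real.pi / 2 - a ≤ Real.arctan (Y / a) := by
    have h1 := Real.arctan_inv_of_pos (div_pos hY ha)
    have h2 : Real.arctan (Y / a)⁻¹ ≤ (Y / a)⁻¹ := by
      have := Real.le_tan (x := Real.arctan (Y / a)⁻¹) (Real.arctan_nonneg.2 (by positivity))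
        (Real.arctan_lt_pi_div_two _)
      rwa [Real.tan_arctan] at this
    have h3 : (Y / a)⁻¹ ≤ a := by
      rw [inv_div]
      exact div_le_self ha.le h.Y_ge
    linarith
  have hpi := Real.pi_gt_three
  have hL := h.L_nonneg
  have s1 : u / a * (a * E) = u * E := by field_simp
  have hr : 0 ≤ u / a := by positivity
  have hra : u / a * a = u := by field_simp
  have K2 := mul_le_mul_of_nonneg_left t2 hr
  have Q3 := mul_le_mul_of_nonneg_left Q2.1 hr
  have K3 : L * (2 * Real.arctan (Y / u) - u / a * (2 * Real.arctan (Y / a))) ≤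
      L * (Real.pi - u / a * Real.pi + 2 * u) := by
    gcongr
    linarith
  have key : Real.pi * (u / a * (Z a).re - L * (1 - u / a)) - 2 * L * u - 2 * (u * E) ≤
      Real.pi * (Z u).re := by
    linarith
  have : 0 ≤ Real.pi * ((Z u).re - (u / a * (Z a).re - L * (1 - u / a) - u * (L + 2 * E))) := by
    nlinarith [mul_nonneg hL hu.le, mul_nonneg hu.le hE]
  linarith [nonneg_of_mul_nonneg_right this Real.pi_pos]

/-- The differential inequality for the real part of `Z` on the real axis, from a kernel with a
double pole. -/
theorem deriv_add_ge (h : BoxBounds Z U X Y A L M B) {u a l : ℝ} (ha : 0 < a) (hau : a ≤ u)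
    (huA : u ≤ A) (hl : 0 ≤ l) :
    -(Real.exp (-(u * l)) / a * ((Z a).re + L)) - (2 * Real.exp (l * X) * sideError X Y A M B +
      L * sideError X Y A 1 (Real.exp (-(l * X)))) ≤ (deriv Z u).re + l * (Z u).re := by
  have hu : 0 < u := ha.trans_le hau
  have hY := h.Y_pos
  have hX := h.X_pos
  have hE := h.sideError_nonneg
  have huX := huA.trans_lt h.A_lt
  have hadd : ∀ w ∈ boxSet X Y, w + u ≠ 0 := by
    intro w hw h0
    have := congrArg re h0
    simp at this
    linarith [hw.1.1]
  have hle : ∀ w ∈ boxSet X Y, ‖w - u‖ ≤ ‖w + u‖ := fun w hw =>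
    (sq_le_sq₀ (norm_nonneg _) (norm_nonneg _)).1 (norm_sub_sq_le_norm_add_sq hw.1.1 hu.le)
  -- `k1` has a double pole at `u` and produces `Z' + l Z` there. `k2` is holomorphic in the box,
  -- and on the left side it is the complex conjugate of the kernel of `k1`; adding the two makes
  -- the boundary kernel real.
  set k1 : ℂ → ℂ := fun w => exp (l * (w - u)) * Z w / (w - u) ^ 2 with hk1
  set k2 : ℂ → ℂ := fun w => exp (-(l * (w + u))) / (w + u) ^ 2 with hk2
  have hdk2 : DifferentiableOn ℂ k2 (boxSet X Y) :=
    DifferentiableOn.div (by fun_prop) (by fun_prop) fun w hw => pow_ne_zero 2 (hadd w hw)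
  have n1 : ∀ w : ℂ, ‖exp (l * (w - u))‖ = Real.exp (l * (w.re - u)) := by
    intro w; rw [norm_exp]; simp
  have n2 : ∀ w : ℂ, ‖exp (-(l * (w + u)))‖ = Real.exp (-(l * (w.re + u))) := by
    intro w; rw [norm_exp]; simp
  have D : deriv (fun w => exp (l * (w - u)) * Z w) u = l * Z u + deriv Z u := by
    have hZ : HasDerivAt Z (deriv Z u) u := (h.diff.differentiableAt (h.isOpen.mem_nhds
      (h.subset (h.ofReal_mem ⟨hu.le, huX.le⟩)))).hasDerivAt
    have he : HasDerivAt (fun w : ℂ => exp (l * (w - u))) (exp (l * (u - u)) * (l * 1)) u :=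
      (((hasDerivAt_id (u : ℂ)).sub_const _).const_mul _).cexp
    have := (he.mul hZ).deriv
    simp only [sub_self, mul_zero, exp_zero, one_mul, mul_one] at this
    exact this
  have B1 := boxIntegral_div_sub_sq hY hu huX h.isOpen h.subset
    (f := fun w => exp (l * (w - u)) * Z w) (DifferentiableOn.mul (by fun_prop) h.diff)
  rw [D] at B1
  have R1 := h.norm_left_add_le (g := k1) (c := Real.exp (l * X)) (u := u) B1
    (Real.exp_pos _).le huA fun w hw _ => by
      simp only [hk1]
      rw [norm_div, norm_mul, n1, norm_pow]
      gcongr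
      linarith [hw.1.2]
  have R2 := h.norm_left_add_le (g := fun w => k2 w * Z w) (r := 0) (c := 1) (u := u) (by
      rw [mul_zero]
      exact boxIntegral_eq_zero hX.le hY.le (hdk2.mul (h.diff.mono h.subset))) one_pos.le huA
      fun w hw h0 => by
      simp only [hk2]
      have h3 : 0 < ‖w - u‖ := norm_pos_iff.2 h0
      rw [norm_mul, norm_div, n2, norm_pow, div_mul_eq_mul_div]
      have := hle w hw
      gcongr
      rw [Real.exp_le_one_iff]
      have := mul_nonneg hl (add_nonneg hw.1.1 hu.le)
      linarith
  have R3 := norm_integral_left_add_le (g := k2) (r := 0) (m := 1 / Y ^ 2)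
    (b := Real.exp (-(l * X))) hX.le hY h.A_lt (by
      rw [mul_zero]
      exact boxIntegral_eq_zero hX.le hY.le hdk2) (fun w hw him => by
      simp only [hk2]
      rw [norm_div, n2, norm_pow]
      have h2 : Y ≤ ‖w + u‖ := by
        have := abs_im_le_norm (w + u)
        simpa [him] using this
      gcongr
      rw [Real.exp_le_one_iff]
      have := mul_nonneg hl (add_nonneg hw.1.1 hu.le)
      linarith) (fun y hy => by
      simp only [hk2]
      rw [norm_div, n2, norm_pow, mul_one_div]
      have := sub_pos.2 h.A_lt
      gcongr
      · simp
        nlinarith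
      · rw [Complex.sq_norm, normSq_apply]
        simp
        nlinarith [h.A_lt, h.A_pos]) (Real.exp_pos _).le
  rw [show 2 * X * (1 / Y ^ 2) + Real.exp (-(l * X)) * (Real.pi / (X - A)) =
    sideError X Y A 1 (Real.exp (-(l * X))) from rfl] at R3
  have R4 := h.norm_poisson_sub_le ha (hau.trans huA)
  set E := sideError X Y A M B
  set E4 := sideError X Y A 1 (Real.exp (-(l * X)))
  have ck2 : Continuous fun y : ℝ => k2 (y * I) := by
    refine Continuous.div (by fun_prop) (by fun_prop) fun y => pow_ne_zero 2 fun h0 => ?_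
    have := congrArg re h0
    simp at this
    linarith
  have c2 := continuous_inv_sq_add_sq ha
  -- On `w = iy` one has `|k2| = e^{-ul} / (u² + y²)`, which for `u ≥ a` is at most `e^{-ul} / (a² +
  -- y²)`. This multiple of the Poisson kernel at `a` makes `k` nonnegative and brings in `Z a`.
  set k : ℝ → ℝ := fun y => Real.exp (-(u * l)) * (1 / (a ^ 2 + y ^ 2)) - (k2 (y * I)).re with hk
  have ck : Continuous k := (continuous_const.mul c2).sub (continuous_re.comp ck2)
  have hk0 : ∀ y, 0 ≤ k y := by
    intro y
    simp only [hk]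
    rw [sub_nonneg]
    refine (re_le_norm _).trans ?_
    simp only [hk2]
    rw [norm_div, n2, norm_pow, Complex.sq_norm, normSq_apply, mul_one_div]
    simp only [mul_re, ofReal_re, I_re, mul_zero, ofReal_im, I_im, mul_one, sub_self, add_re,
      zero_add, add_im, mul_im, add_zero, mul_comm l u]
    gcongr
    · nlinarith
    · exact (sq y).le
  have K := h.integral_re_ge ck hk0
  have ek : ∫ y in (-Y)..Y, k y = Real.exp (-(u * l)) * (2 * Real.arctan (Y / a) / a) -
      (∫ y : ℝ in (-Y)..Y, k2 (y * I)).re := by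
    have e : (∫ y : ℝ in (-Y)..Y, k2 (y * I)).re = ∫ y : ℝ in (-Y)..Y, (k2 (y * I)).re :=
      (reCLM.intervalIntegral_comp_comm (ck2.intervalIntegrable _ _)).symm
    rw [e, intervalIntegral.integral_sub, intervalIntegral.integral_const_mul,
      integral_inv_sq_add_sq_eq ha]
    · exact (continuous_const.mul c2).intervalIntegrable _ _
    · exact (continuous_re.comp ck2).intervalIntegrable _ _
  have hconj : ∀ y : ℝ, exp (l * (y * I - u)) / (y * I - u) ^ 2 =
      (starRingEnd ℂ) (k2 (y * I)) := by
    intro y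
    simp only [hk2, map_div₀, map_pow, ← exp_conj, map_neg, map_mul, map_add, conj_ofReal, conj_I]
    congr 1
    · congr 1; ring
    · ring
  have eZ : (∫ y : ℝ in (-Y)..Y, (k y : ℂ) * Z (y * I)) =
      (Real.exp (-(u * l)) / a : ℝ) *
        (∫ y : ℝ in (-Y)..Y, (a * (1 / (a ^ 2 + y ^ 2)) : ℝ) * Z (y * I)) -
      (1 / 2) * ((∫ y : ℝ in (-Y)..Y, k1 (y * I)) + ∫ y : ℝ in (-Y)..Y, k2 (y * I) * Z (y * I))
        := by
    have i2 : IntervalIntegrable (fun y : ℝ => k2 (y * I) * Z (y * I)) volume (-Y) Y :=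
      (ck2.continuousOn.mul h.continuousOn_left).intervalIntegrable
    have e1 : (fun y : ℝ => k1 (y * I)) =
        fun y : ℝ => (starRingEnd ℂ) (k2 (y * I)) * Z (y * I) := by
      ext y
      rw [← hconj]
      simp only [hk1]
      ring
    have i1 : IntervalIntegrable (fun y : ℝ => k1 (y * I)) volume (-Y) Y := by
      rw [e1]
      exact ((continuous_conj.comp ck2).continuousOn.mul h.continuousOn_left).intervalIntegrable
    have i3 : IntervalIntegrable (fun y : ℝ => ((a * (1 / (a ^ 2 + y ^ 2)) : ℝ) : ℂ) * Z (y * I))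
        volume (-Y) Y := ((continuous_ofReal.comp (continuous_const.mul
          c2)).continuousOn.mul h.continuousOn_left).intervalIntegrable
    rw [← intervalIntegral.integral_add i1 i2, ← intervalIntegral.integral_const_mul,
      ← intervalIntegral.integral_const_mul,
      ← intervalIntegral.integral_sub (i3.const_mul _) ((i1.add i2).const_mul _)]
    refine integral_congr fun y _ => ?_
    have e2 := congrFun e1 y
    have e3 := Complex.re_eq_add_conj (k2 (y * I))
    simp only [hk] at *
    rw [e2]
    push_cast
    rw [e3]
    have : (a : ℂ) ≠ 0 := ofReal_ne_zero.2 ha.ne'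
    field_simp
    ring
  rw [ek, eZ, sub_re, re_ofReal_mul, show (1 / 2 : ℂ) = ((1 / 2 : ℝ) : ℂ) by norm_num,
    re_ofReal_mul, add_re] at K
  have Q1 := abs_le.1 ((abs_re_le_norm _).trans R1)
  have Q2 := abs_le.1 ((abs_re_le_norm _).trans R2)
  have Q3 := abs_le.1 ((abs_re_le_norm _).trans R3)
  have Q4 := abs_le.1 ((abs_re_le_norm _).trans R4)
  rw [show (2 * Real.pi : ℂ) = ((2 * Real.pi : ℝ) : ℂ) by norm_num, add_re, re_ofReal_mul,
    add_re, re_ofReal_mul] at Q1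
  rw [mul_zero, add_zero] at Q2 Q3
  rw [sub_re, re_ofReal_mul] at Q4
  set J1 := (∫ y : ℝ in (-Y)..Y, k1 (y * I)).re
  set J2 := (∫ y : ℝ in (-Y)..Y, k2 (y * I) * Z (y * I)).re
  set J3 := (∫ y : ℝ in (-Y)..Y, k2 (y * I)).re
  set J4 := (∫ y : ℝ in (-Y)..Y, (a * (1 / (a ^ 2 + y ^ 2)) : ℝ) * Z (y * I)).re
  have hL := h.L_nonneg
  have hpi := Real.pi_gt_three
  have hra : 0 ≤ Real.exp (-(u * l)) / a := by positivity
  have t1 : Real.exp (-(u * l)) * (2 * Real.arctan (Y / a) / a) ≤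
      Real.exp (-(u * l)) / a * Real.pi := by
    rw [show Real.exp (-(u * l)) * (2 * Real.arctan (Y / a) / a) =
      Real.exp (-(u * l)) / a * (2 * Real.arctan (Y / a)) by ring]
    gcongr
    linarith [Real.arctan_lt_pi_div_two (Y / a)]
  have t2 : L * (Real.exp (-(u * l)) * (2 * Real.arctan (Y / a) / a) - J3) ≤
      L * (Real.exp (-(u * l)) / a * Real.pi + E4) := by
    gcongr
    linarith
  have t3 := mul_le_mul_of_nonneg_left Q4.2 hra
  have t4 : Real.exp (-(u * l)) / a * (a * E) = Real.exp (-(u * l)) * E := by field_simp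
  have t5 : Real.exp (-(u * l)) * E ≤ Real.exp (l * X) * E := by
    gcongr
    nlinarith
  have t6 : 1 * E ≤ Real.exp (l * X) * E := by
    gcongr
    exact Real.one_le_exp (by positivity)
  have key : -(Real.pi * (Real.exp (-(u * l)) / a * ((Z a).re + L))) - 2 * (Real.exp (l * X) * E) -
      L * E4 ≤ Real.pi * ((deriv Z u).re + l * (Z u).re) := by
    linarith
  have hE4 : 0 ≤ L * E4 := mul_nonneg hL ((norm_nonneg _).trans R3)
  have hE5 : 0 ≤ Real.exp (l * X) * E := by positivity
  have : 0 ≤ Real.pi * ((deriv Z u).re + l * (Z u).re -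
      (-(Real.exp (-(u * l)) / a * ((Z a).re + L)) - (2 * Real.exp (l * X) * E + L * E4))) := by
    nlinarith
  linarith [nonneg_of_mul_nonneg_right this Real.pi_pos]

end BoxBounds

namespace BoxBounds

variable {Z : ℂ → ℂ} {U : Set ℂ} {X Y A L M B : ℝ}

/-- The mean of `Re Z` over `[0, A]` is at least `-(1 + m) L / l` up to an error, where
`exp (-m) = m + m ^ 2 / 2`. -/
theorem integral_re_ge_of_exp_eq (h : BoxBounds Z U X Y A L M B) {m l : ℝ} (hm : 0 < m)
    (hm' : Real.exp (-m) = m + m ^ 2 / 2) (hl : 0 < l) (hA : m / l ≤ A) :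
    -((1 + m) * L / l) - (m / l) ^ 2 / 2 * (L + 2 * sideError X Y A M B) -
      (B + A * (2 * Real.exp (l * X) * sideError X Y A M B +
        L * sideError X Y A 1 (Real.exp (-(l * X))))) / l ≤ ∫ u : ℝ in (0 : ℝ)..A, (Z u).re := by
  set a := m / l with ha_def
  set E := sideError X Y A M B
  set E2 := 2 * Real.exp (l * X) * E + L * sideError X Y A 1 (Real.exp (-(l * X))) with hE2
  have ha : 0 < a := div_pos hm hl
  have hAX := h.A_lt
  have hE2n : 0 ≤ E2 := by
    have h1 := h.sideError_nonneg
    have h2 := h.L_nonneg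
    have h3 := h.X_pos
    have h4 := sub_pos.2 h.A_lt
    have h5 := Real.pi_pos
    have : 0 ≤ sideError X Y A 1 (Real.exp (-(l * X))) := by
      unfold sideError
      positivity
    positivity
  have hmem : ∀ u ∈ Icc 0 A, (u : ℂ) ∈ U := fun u hu =>
    h.subset (h.ofReal_mem ⟨hu.1, hu.2.trans hAX.le⟩)
  have hcZ : ContinuousOn (fun u : ℝ => (Z u).re) (Icc 0 A) :=
    continuous_re.comp_continuousOn (h.diff.continuousOn.comp (by fun_prop) hmem)
  have hcD : ContinuousOn (fun u : ℝ => (deriv Z u).re) (Icc 0 A) :=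
    continuous_re.comp_continuousOn
      ((h.diff.deriv h.isOpen).continuousOn.comp (by fun_prop) hmem)
  have s1 : Icc 0 a ⊆ Icc 0 A := Icc_subset_Icc_right hA
  have s2 : Icc a A ⊆ Icc 0 A := Icc_subset_Icc_left ha.le
  have i1 : IntervalIntegrable (fun u : ℝ => (Z u).re) volume 0 a :=
    (hcZ.mono s1).intervalIntegrable_of_Icc ha.le
  have i2 : IntervalIntegrable (fun u : ℝ => (Z u).re) volume a A :=
    (hcZ.mono s2).intervalIntegrable_of_Icc hA
  have i3 : IntervalIntegrable (fun u : ℝ => (deriv Z u).re) volume a A :=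
    (hcD.mono s2).intervalIntegrable_of_Icc hA
  -- On `[0, a]` the Harnack lower bound is affine in `u` and is integrated exactly.
  have part1 : a / 2 * (Z a).re - L * (a / 2) - a ^ 2 / 2 * (L + 2 * E) ≤
      ∫ u : ℝ in (0 : ℝ)..a, (Z u).re := by
    have e : ∫ u : ℝ in (0 : ℝ)..a, (u * ((Z a).re / a + L / a - (L + 2 * E)) - L) =
        a / 2 * (Z a).re - L * (a / 2) - a ^ 2 / 2 * (L + 2 * E) := by
      rw [intervalIntegral.integral_sub, intervalIntegral.integral_mul_const, integral_id,
        intervalIntegral.integral_const]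
      · simp only [smul_eq_mul]
        field_simp
        ring
      · exact Continuous.intervalIntegrable (by fun_prop) _ _
      · exact Continuous.intervalIntegrable (by fun_prop) _ _
    rw [← e]
    refine integral_mono_on_of_le_Ioo ha.le (Continuous.intervalIntegrable (by fun_prop) _ _) i1
      fun u hu => ?_
    refine le_of_eq_of_le ?_ (h.harnack hu.1 hu.2.le hA)
    field_simp
    ring
  have hha : 0 ≤ (Z a).re + L := by
    linarith [h.neg_L_le a (h.ofReal_mem ⟨ha.le, hA.trans hAX.le⟩)]
  -- On `[a, A]` the differential inequality is integrated. As `a * l = m`, the exponential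
  -- contributes at most `e^{-m} / m`.
  have part2 : -(Real.exp (-m) / m * ((Z a).re + L)) - A * E2 ≤
      (Z A).re - (Z a).re + l * ∫ u : ℝ in a..A, (Z u).re := by
    have e1 : ∫ u : ℝ in a..A, (deriv Z u).re = (Z A).re - (Z a).re := by
      refine integral_eq_sub_of_hasDerivAt (f := fun u : ℝ => (Z u).re) (fun u hu => ?_) i3
      rw [uIcc_of_le hA] at hu
      exact ((h.diff.differentiableAt (h.isOpen.mem_nhds
        (hmem u (s2 hu)))).hasDerivAt.real_of_complex)
    rw [← e1, ← intervalIntegral.integral_const_mul, ← intervalIntegral.integral_add i3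
      (i2.const_mul _)]
    have e2 : ∫ u : ℝ in a..A, (-(Real.exp (-(u * l)) / a * ((Z a).re + L)) - E2) =
        -((Real.exp (-m) - Real.exp (-(A * l))) / m * ((Z a).re + L)) - (A - a) * E2 := by
      have hd : ∀ u ∈ uIcc a A, HasDerivAt
          (fun u => Real.exp (-(u * l)) / (a * l) * ((Z a).re + L) - u * E2)
          (-(Real.exp (-(u * l)) / a * ((Z a).re + L)) - E2) u := by
        intro u _
        have := (((((((hasDerivAt_id u).mul_const l).fun_neg).exp).div_const (a * l)).mul_const
          ((Z a).re + L))).sub ((hasDerivAt_id u).mul_const E2)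
        refine this.congr_deriv ?_
        simp only [id]
        field_simp
      rw [integral_eq_sub_of_hasDerivAt hd (Continuous.intervalIntegrable (by fun_prop) _ _)]
      have : a * l = m := by rw [ha_def]; field_simp
      rw [this]
      ring
    refine le_trans ?_ (integral_mono_on hA (Continuous.intervalIntegrable (by fun_prop) _ _)
      (i3.add (i2.const_mul _)) fun u hu => h.deriv_add_ge ha hu.1 hu.2 hl.le)
    rw [e2]
    have : (Real.exp (-m) - Real.exp (-(A * l))) / m * ((Z a).re + L) ≤
        Real.exp (-m) / m * ((Z a).re + L) := by
      gcongr
      linarith [Real.exp_pos (-(A * l))]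
    nlinarith
  have hZA := h.norm_le_B A (h.ofReal_mem ⟨h.A_pos.le, hAX.le⟩) (by simp)
  have hZA' := (re_le_norm _).trans hZA
  rw [← integral_add_adjacent_intervals i1 i2]
  -- The equation for `m` enters here: the coefficient of `(Z a).re` becomes `1 - (1 + m/2) = -m/2`,
  -- which after division by `l` cancels the coefficient `a / 2` of `part1`.
  have e3 : Real.exp (-m) / m = 1 + m / 2 := by rw [hm']; field_simp
  rw [e3] at part2
  have part3 : (-(m / 2) * (Z a).re - (1 + m / 2) * L - (B + A * E2)) / l ≤
      ∫ u : ℝ in a..A, (Z u).re := by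
    rw [div_le_iff₀ hl]
    linarith
  have e4 : -((1 + m) * L / l) - a ^ 2 / 2 * (L + 2 * E) - (B + A * E2) / l =
      (a / 2 * (Z a).re - L * (a / 2) - a ^ 2 / 2 * (L + 2 * E)) +
      (-(m / 2) * (Z a).re - (1 + m / 2) * L - (B + A * E2)) / l := by
    rw [ha_def]
    field_simp
    ring
  rw [e4]
  exact add_le_add part1 part3

end BoxBounds

end

section

open Set Complex MeasureTheory Metric

/-! ### Zero-free functions on a ball -/

/-- A holomorphic logarithm of `f / f c` on a ball, bounded by means of the Borel–Carathéodory
theorem. -/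
theorem exists_log_on_ball {f : ℂ → ℂ} {c : ℂ} {R k : ℝ} (hR : 0 < R) (hk : 0 < k)
    (hf : DifferentiableOn ℂ f (ball c R)) (h0 : ∀ z ∈ ball c R, f z ≠ 0)
    (hb : ∀ z ∈ ball c R, ‖f z‖ ≤ Real.exp k * ‖f c‖) :
    ∃ g : ℂ → ℂ, (∀ z ∈ ball c R, HasDerivAt g (logDeriv f z) z) ∧
      (∀ z ∈ ball c R, f z = f c * exp (g z)) ∧
      ∀ z ∈ ball c R, ‖g z‖ ≤ 2 * k * ‖z - c‖ / (R - ‖z - c‖) := by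
  have hcb : c ∈ ball c R := mem_ball_self hR
  have hld : DifferentiableOn ℂ (logDeriv f) (ball c R) := (hf.deriv isOpen_ball).div hf h0
  obtain ⟨g, hgc, hg⟩ := hld.isExactOn_ball.with_val_at c 0
  have hgd : DifferentiableOn ℂ g (ball c R) := fun z hz =>
    (hg z hz).differentiableAt.differentiableWithinAt
  have hfg : ∀ z ∈ ball c R, f z = f c * exp (g z) := by
    intro z hz
    have hconst : f z * exp (-g z) = f c * exp (-g c) := by
      refine (isOpen_ball).is_const_of_deriv_eq_zero (convex_ball c R).isPreconnected
        (f := fun z => f z * exp (-g z)) (hf.mul hgd.neg.cexp) (fun w hw => ?_) hz hcb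
      have hfw := (hf.differentiableAt (isOpen_ball.mem_nhds hw)).hasDerivAt
      have := (hfw.mul (hg w hw).fun_neg.cexp).deriv
      refine Eq.trans this ?_
      simp only [logDeriv_apply, Pi.zero_apply]
      have := h0 w hw
      field_simp
      ring
    rw [hgc, neg_zero, exp_zero, mul_one] at hconst
    rw [← hconst, mul_assoc, ← exp_add, neg_add_cancel, exp_zero, mul_one]
  refine ⟨g, hg, hfg, fun z hz => ?_⟩
  have hmap : ∀ w ∈ ball (0 : ℂ) R, c + w ∈ ball c R := fun w hw => by
    simpa [mem_ball, dist_eq_norm] using hw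
  have := borelCaratheodory_zero (f := fun w => g (c + w)) (z := z - c) (R := R) hk
    (hgd.comp (by fun_prop) hmap) (fun w hw => ?_) hR ?_ (by simp [hgc])
  · simpa using this
  · have h1 := hb _ (hmap w hw)
    rw [hfg _ (hmap w hw), norm_mul, norm_exp, mul_comm] at h1
    have h2 : 0 < ‖f c‖ := norm_pos_iff.2 (h0 c hcb)
    exact Real.exp_le_exp.1 (le_of_mul_le_mul_right h1 h2)
  · simpa [dist_eq_norm] using hz

/-- Cauchy's estimate for the logarithm `g` on a circle of radius `R / 4` about `z`, which stays
within `R / 2` of `c`, where `‖g‖ ≤ 2 * k`. -/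
theorem norm_logDeriv_le_of_ball {f : ℂ → ℂ} {c : ℂ} {R k : ℝ} (hR : 0 < R) (hk : 0 < k)
    (hf : DifferentiableOn ℂ f (ball c R)) (h0 : ∀ z ∈ ball c R, f z ≠ 0)
    (hb : ∀ z ∈ ball c R, ‖f z‖ ≤ Real.exp k * ‖f c‖) {z : ℂ} (hz : ‖z - c‖ ≤ R / 4) :
    ‖logDeriv f z‖ ≤ 8 * k / R := by
  obtain ⟨g, hg, -, hgb⟩ := exists_log_on_ball hR hk hf h0 hb
  have hsub : closedBall z (R / 4) ⊆ ball c R := by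
    refine closedBall_subset_ball' ?_
    rw [dist_eq_norm]
    linarith
  have hzb : z ∈ ball c R := hsub (mem_closedBall_self (by positivity))
  have hd : DiffContOnCl ℂ g (ball z (R / 4)) := by
    refine DifferentiableOn.diffContOnCl fun w hw => ?_
    exact (hg w (hsub (closure_ball_subset_closedBall hw))).differentiableAt.differentiableWithinAt
  rw [← (hg z hzb).deriv]
  refine (norm_deriv_le_of_forall_mem_sphere_norm_le (C := 2 * k) (by positivity : 0 < R / 4) hd
    fun w hw => ?_).trans_eq (by field_simp; norm_num)
  refine (hgb w (hsub (sphere_subset_closedBall hw))).trans ?_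
  have h1 : ‖w - c‖ ≤ R / 2 := by
    have := norm_sub_le_norm_sub_add_norm_sub w z c
    rw [mem_sphere, dist_eq_norm] at hw
    linarith
  rw [div_le_iff₀ (by linarith)]
  nlinarith [norm_nonneg (w - c)]

theorem norm_ge_of_ball {f : ℂ → ℂ} {c : ℂ} {R k : ℝ} (hR : 0 < R) (hk : 0 < k)
    (hf : DifferentiableOn ℂ f (ball c R)) (h0 : ∀ z ∈ ball c R, f z ≠ 0)
    (hb : ∀ z ∈ ball c R, ‖f z‖ ≤ Real.exp k * ‖f c‖) {z : ℂ} (hz : z ∈ ball c R) :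
    ‖f c‖ * Real.exp (-(2 * k * ‖z - c‖ / (R - ‖z - c‖))) ≤ ‖f z‖ := by
  obtain ⟨g, -, hfg, hgb⟩ := exists_log_on_ball hR hk hf h0 hb
  rw [hfg z hz, norm_mul, norm_exp]
  gcongr
  have := abs_re_le_norm (g z)
  linarith [hgb z hz, neg_abs_le (g z).re]

/-! ### Gamma and digamma estimates without Stirling's formula -/

theorem norm_Gamma_le_Gamma_re {s : ℂ} (hs : 0 < s.re) : ‖Gamma s‖ ≤ Real.Gamma s.re := by
  rw [Gamma_eq_integral hs, Real.Gamma_eq_integral hs, GammaIntegral]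
  refine norm_integral_le_of_norm_le (Real.GammaIntegral_convergent hs) ?_
  refine (ae_restrict_iff' measurableSet_Ioi).2 (ae_of_all _ fun x hx => ?_)
  rw [norm_mul, norm_real, Real.norm_of_nonneg (Real.exp_pos _).le,
    norm_cpow_eq_rpow_re_of_pos hx]
  simp

/-- From `Γ(w)Γ(h) = Γ(w + h)B(w, h)`: for `Re w ≥ 1` the Beta integral is at most `∫₀¹ (1 -
x)^(h-1) = 1/h`, uniformly in `Im w`. -/
theorem norm_Gamma_le_norm_Gamma_add {w : ℂ} {h : ℝ} (hw : 1 ≤ w.re) (hh : 0 < h) :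
    ‖Gamma w‖ ≤ ‖Gamma (w + h)‖ / Real.Gamma (h + 1) := by
  have h1 := Gamma_mul_Gamma_eq_betaIntegral (s := w) (t := h) (by linarith) (by simpa)
  have h2 : ‖betaIntegral w h‖ ≤ 1 / h := by
    have hi : ∫ x in (0 : ℝ)..1, (1 - x) ^ (h - 1) = 1 / h := by
      rw [intervalIntegral.integral_comp_sub_left (fun x : ℝ => x ^ (h - 1)) 1, sub_self, sub_zero,
        integral_rpow (Or.inl (by linarith))]
      simp [Real.zero_rpow hh.ne']
    rw [← hi]
    refine intervalIntegral.norm_integral_le_of_norm_le zero_le_one ?_ ?_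
    · refine ae_of_all _ fun x hx => ?_
      have e : (1 - x : ℂ) ^ (h - 1 : ℂ) = (((1 - x) ^ (h - 1) : ℝ) : ℂ) := by
        rw [ofReal_cpow (by linarith [hx.2])]
        push_cast
        rfl
      have h0 : (0 : ℝ) ≤ (1 - x) ^ (h - 1) := Real.rpow_nonneg (by linarith [hx.2]) _
      rw [norm_mul, e, norm_real, Real.norm_of_nonneg h0, norm_cpow_eq_rpow_re_of_pos hx.1]
      refine mul_le_of_le_one_left h0 (Real.rpow_le_one hx.1.le hx.2 ?_)
      simpa using hw
    · have := (intervalIntegral.intervalIntegrable_rpow' (a := 1 - 0) (b := 1 - 1) (r := h - 1)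
        (by linarith)).comp_sub_left 1
      simpa using this
  rw [Gamma_ofReal] at h1
  have h3 := congrArg norm h1
  rw [norm_mul, norm_mul, norm_real, Real.norm_of_nonneg (Real.Gamma_pos_of_pos hh).le] at h3
  rw [Real.Gamma_add_one hh.ne', le_div_iff₀ (by have := Real.Gamma_pos_of_pos hh; positivity)]
  have h4 : ‖Gamma w‖ * Real.Gamma h ≤ ‖Gamma (w + h)‖ * (1 / h) := by
    rw [h3]; gcongr
  calc ‖Gamma w‖ * (h * Real.Gamma h) = h * (‖Gamma w‖ * Real.Gamma h) := by ring
    _ ≤ h * (‖Gamma (w + h)‖ * (1 / h)) := by gcongr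
    _ = _ := by field_simp

theorem norm_sin_le_exp (z : ℂ) : ‖sin z‖ ≤ Real.exp |z.im| := by
  rw [sin, norm_div, norm_mul, norm_I, mul_one, norm_ofNat, div_le_iff₀ two_pos]
  refine (norm_sub_le _ _).trans ?_
  rw [norm_exp, norm_exp]
  have h1 : Real.exp (-z * I).re ≤ Real.exp |z.im| := by
    gcongr; simpa using le_abs_self z.im
  have h2 : Real.exp (z * I).re ≤ Real.exp |z.im| := by
    gcongr; simpa using neg_le_abs z.im
  linarith

/-- On this line the reflection formula reads `|Γ|² = π / |sin|`, and the sine is at most `exp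
(π|v|)`. -/
theorem norm_Gamma_half_add_sq_ge (v : ℝ) :
    Real.exp (-(Real.pi * |v|)) ≤ ‖Gamma (1 / 2 + v * I)‖ ^ 2 := by
  have h1 := Gamma_mul_Gamma_one_sub (1 / 2 + v * I)
  have h2 : (1 - (1 / 2 + v * I) : ℂ) = (starRingEnd ℂ) (1 / 2 + v * I) := by
    rw [map_add, map_mul, conj_ofReal, conj_I, map_div₀, map_one, map_ofNat]
    ring
  rw [h2, Gamma_conj, mul_conj, normSq_eq_norm_sq] at h1
  have h3 := congrArg norm h1
  rw [norm_real, Real.norm_of_nonneg (by positivity), norm_div, norm_real,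
    Real.norm_of_nonneg Real.pi_pos.le] at h3
  have h4 := norm_sin_le_exp (Real.pi * (1 / 2 + v * I))
  have h5 : |(Real.pi * (1 / 2 + v * I) : ℂ).im| = Real.pi * |v| := by
    simp [abs_mul, abs_of_pos Real.pi_pos]
  rw [h5] at h4
  have h6 : 0 < ‖sin (Real.pi * (1 / 2 + v * I))‖ := by
    refine norm_pos_iff.2 fun h0 => ?_
    rw [h0, norm_zero, div_zero] at h3
    refine Gamma_ne_zero_of_re_pos (s := 1 / 2 + v * I) (by simp) ?_
    simpa using h3
  rw [h3, Real.exp_neg, le_div_iff₀ h6, inv_mul_le_iff₀ (Real.exp_pos _)]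
  nlinarith [Real.pi_gt_three]

/-- Upper bound for the Gamma function near a large integer. -/
theorem Gamma_nat_add_le {N : ℕ} (hN : 4 ≤ N) {a : ℝ} (ha : |a| < N / 2) :
    Real.Gamma (N + a) ≤ Real.Gamma N * (N : ℝ) ^ a * Real.exp N := by
  have hN' : (4 : ℝ) ≤ N := by exact_mod_cast hN
  obtain ⟨ha1, ha2⟩ := abs_lt.1 ha
  have hadd : ∀ x : ℝ, 0 < x → Real.log (Real.Gamma (x + 1)) = Real.log x +
      Real.log (Real.Gamma x) := fun x hx => by
    rw [Real.Gamma_add_one hx.ne', Real.log_mul hx.ne' (Real.Gamma_pos_of_pos hx).ne']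
  have hG : ∀ x : ℝ, 0 < x → 0 < Real.Gamma x := fun x => Real.Gamma_pos_of_pos
  suffices H : Real.log (Real.Gamma (N + a)) ≤ Real.log (Real.Gamma N) + a * Real.log N + N by
    rw [← Real.exp_log (hG (N + a) (by linarith)), ← Real.exp_log (hG N (by linarith)),
      Real.rpow_def_of_pos (by linarith), ← Real.exp_add, ← Real.exp_add]
    gcongr
    linarith
  -- Log-convexity compares the slope between `N` and `N + a` with a neighbouring unit slope, which
  -- is a logarithm by `Γ(x + 1) = xΓ(x)`. Replacing that logarithm by `log N` costs at most `2|a| <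
  -- N`.
  have conv := Real.convexOn_log_Gamma
  have mem : ∀ x : ℝ, 0 < x → x ∈ Ioi (0 : ℝ) := fun x hx => hx
  rcases lt_trichotomy a 0 with h | h | h
  · have s := conv.slope_mono_adjacent (x := N + a - 1) (y := N + a) (z := N)
      (mem _ (by linarith)) (mem _ (by linarith)) (by linarith) (by linarith)
    have e := hadd (N + a - 1) (by linarith)
    rw [sub_add_cancel] at e
    simp only [Function.comp] at s
    rw [e, sub_sub_cancel, div_one, le_div_iff₀ (by linarith)] at s
    have l1 : Real.log N ≤ Real.log (N + a - 1) + Real.log 4 := by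
      rw [← Real.log_mul (by linarith) (by norm_num)]
      exact Real.log_le_log (by linarith) (by linarith)
    have l2 : Real.log 4 ≤ 2 := by
      have := Real.log_two_lt_d9
      rw [show (4 : ℝ) = 2 ^ 2 by norm_num, Real.log_pow]
      push_cast
      linarith
    nlinarith
  · simp [h]
  · have s := conv.slope_mono_adjacent (x := N) (y := N + a) (z := N + a + 1)
      (mem _ (by linarith)) (mem _ (by linarith)) (by linarith) (by linarith)
    simp only [Function.comp] at s
    rw [hadd (N + a) (by linarith), add_sub_cancel_left, add_sub_cancel_left, div_one,
      add_sub_cancel_right, div_le_iff₀ h] at s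
    have l1 : Real.log (N + a) ≤ Real.log N + Real.log 2 := by
      rw [← Real.log_mul (by linarith) (by norm_num)]
      exact Real.log_le_log (by linarith) (by linarith)
    have := Real.log_two_lt_d9
    nlinarith

/-- `Γ(N + z) N^{-z}` is zero-free on `|z| < N/2` and at most `e^N Γ(N)` there, so
`norm_logDeriv_le_of_ball` gives `8N / (N/2) = 16`. -/
theorem norm_logDeriv_Gamma_sub_log_le {N : ℕ} (hN : 4 ≤ N) {v : ℂ} (hv : ‖v‖ ≤ N / 8) :
    ‖logDeriv Gamma (N + v) - Real.log N‖ ≤ 16 := by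
  have hN' : (4 : ℝ) ≤ N := by exact_mod_cast hN
  have hN0 : (N : ℂ) ≠ 0 := by exact_mod_cast (by linarith : (N : ℝ) ≠ 0)
  have hre : ∀ z ∈ ball (0 : ℂ) (N / 2), |z.re| < N / 2 := fun z hz =>
    (abs_re_le_norm z).trans_lt (by simpa using hz)
  have hpos : ∀ z ∈ ball (0 : ℂ) (N / 2), 0 < (N + z).re := fun z hz => by
    have := (abs_lt.1 (hre z hz)).1
    simp
    linarith
  have hdG : ∀ z ∈ ball (0 : ℂ) (N / 2), DifferentiableAt ℂ (fun z => Gamma (N + z)) z :=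
    fun z hz => by
      have h1 : DifferentiableAt ℂ Gamma (N + z) := differentiableAt_Gamma _ fun m h => by
        have := hpos z hz
        rw [h] at this
        simp at this
        linarith [(Nat.cast_nonneg m : (0 : ℝ) ≤ m)]
      exact h1.comp z (by fun_prop)
  set f : ℂ → ℂ := fun z => Gamma (N + z) * exp (-(z * Real.log N)) with hf
  have hfd : ∀ z ∈ ball (0 : ℂ) (N / 2), DifferentiableAt ℂ f z := fun z hz =>
    (hdG z hz).mul (by fun_prop)
  have hvb : v ∈ ball (0 : ℂ) (N / 2) := by
    rw [mem_ball_zero_iff]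
    linarith
  have h1 := norm_logDeriv_le_of_ball (f := f) (c := 0) (R := N / 2) (k := N) (z := v)
    (by linarith) (by linarith) (fun z hz => (hfd z hz).differentiableWithinAt)
    (fun z hz => mul_ne_zero (Gamma_ne_zero_of_re_pos (hpos z hz)) (exp_ne_zero _))
    (fun z hz => by
      have h2 := norm_Gamma_le_Gamma_re (hpos z hz)
      have h3 := Gamma_nat_add_le hN (hre z hz)
      have h4 : (N + z).re = N + z.re := by simp
      rw [h4] at h2
      simp only [hf]
      rw [norm_mul, norm_exp, zero_mul, neg_zero, exp_zero, mul_one, add_zero,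
        ← ofReal_natCast N, Gamma_ofReal, norm_real, ofReal_natCast,
        Real.norm_of_nonneg (Real.Gamma_pos_of_pos (by linarith : (0 : ℝ) < N)).le]
      have h5 : (N : ℝ) ^ z.re * Real.exp (-(z * Real.log N)).re = 1 := by
        rw [Real.rpow_def_of_pos (by linarith), ← Real.exp_add, neg_re, re_mul_ofReal, mul_comm,
          add_neg_cancel, Real.exp_zero]
      calc _ ≤ Real.Gamma N * (N : ℝ) ^ z.re * Real.exp N * Real.exp (-(z * Real.log N)).re := by
            gcongr
            exact h2.trans h3
        _ = Real.exp N * Real.Gamma N *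
              ((N : ℝ) ^ z.re * Real.exp (-(z * Real.log N)).re) := by ring
        _ = _ := by rw [h5, mul_one]) (by rw [sub_zero]; linarith)
  have h2 : logDeriv f v = logDeriv Gamma (N + v) - Real.log N := by
    have e1 := logDeriv_mul (f := fun z => Gamma (N + z)) (g := fun z => exp (-(z * Real.log N))) v
      (Gamma_ne_zero_of_re_pos (hpos v hvb)) (exp_ne_zero _) (hdG v hvb) (by fun_prop)
    have e2 : logDeriv (fun z => Gamma (N + z)) v = logDeriv Gamma (N + v) := by
      simp only [logDeriv_apply, deriv_comp_const_add]
    have e3 : logDeriv (fun z : ℂ => exp (-(z * Real.log N))) v = -Real.log N := by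
      have : HasDerivAt (fun z : ℂ => exp (-(z * Real.log N)))
          (exp (-(v * Real.log N)) * -(1 * Real.log N)) v :=
        ((hasDerivAt_id v).mul_const _).fun_neg.cexp
      rw [logDeriv_apply, this.deriv, one_mul, mul_div_cancel_left₀ _ (exp_ne_zero _)]
    rw [sub_eq_add_neg, ← e2, ← e3]
    exact e1
  rw [h2] at h1
  refine h1.trans_eq ?_
  field_simp
  norm_num

theorem logDeriv_Gamma_add_nat {w : ℂ} (hw : 0 < w.re) (N : ℕ) :
    logDeriv Gamma (w + N) = logDeriv Gamma w + ∑ k ∈ Finset.range N, (w + k)⁻¹ := by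
  induction N with
  | zero => simp
  | succ n ih =>
    have h1 := digamma_apply_add_one (w + n) fun m h => by
      have := congrArg re h
      simp at this
      linarith [(Nat.cast_nonneg m : (0 : ℝ) ≤ m), (Nat.cast_nonneg n : (0 : ℝ) ≤ n)]
    rw [digamma_def] at h1
    rw [Finset.sum_range_succ, ← add_assoc, ← ih, ← h1]
    push_cast
    ring_nf

/-- The digamma function is `log ‖w‖ + O(1)` in the right half-plane away from the origin. -/
theorem norm_logDeriv_Gamma_sub_log_norm_le {w : ℂ} (hw : 0 < w.re) (hw1 : 1 ≤ ‖w‖) :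
    ‖logDeriv Gamma w - Real.log ‖w‖‖ ≤ 40 := by
  -- Shifting by `N` of the order of `8‖w‖` makes `w` small relative to `N`, while the `N` terms of
  -- the recurrence, each at most `1 / ‖w‖`, still sum to `O(1)`.
  set N : ℕ := ⌈8 * ‖w‖⌉₊ with hN
  have h1 : 8 * ‖w‖ ≤ N := Nat.le_ceil _
  have h2 : (N : ℝ) ≤ 9 * ‖w‖ := by
    have := Nat.ceil_lt_add_one (show 0 ≤ 8 * ‖w‖ by positivity)
    rw [← hN] at this
    linarith
  have h3 : 4 ≤ N := by
    have : (4 : ℝ) ≤ N := by linarith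
    exact_mod_cast this
  have h4 := norm_logDeriv_Gamma_sub_log_le h3 (v := w) (by linarith)
  rw [add_comm, logDeriv_Gamma_add_nat hw] at h4
  have h5 : ‖∑ k ∈ Finset.range N, (w + k)⁻¹‖ ≤ 9 := by
    refine (norm_sum_le_of_le (Finset.range N) (f := fun k : ℕ => (w + k)⁻¹)
      (n := fun _ => ‖w‖⁻¹) fun k _ => ?_).trans ?_
    · rw [norm_inv]
      gcongr
      refine (sq_le_sq₀ (norm_nonneg _) (norm_nonneg _)).1 ?_
      rw [Complex.sq_norm, Complex.sq_norm, normSq_apply, normSq_apply]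
      simp
      nlinarith [(Nat.cast_nonneg k : (0 : ℝ) ≤ k)]
    · rw [Finset.sum_const, Finset.card_range, nsmul_eq_mul, ← div_eq_mul_inv,
        div_le_iff₀ (by linarith)]
      exact h2
  have h6 : ‖(Real.log N : ℂ) - Real.log ‖w‖‖ ≤ 9 := by
    rw [← ofReal_sub, norm_real, ← Real.log_div (by linarith) (by linarith),
      Real.norm_of_nonneg (Real.log_nonneg _)]
    · refine (Real.log_le_sub_one_of_pos (by positivity)).trans ?_
      have : (N : ℝ) / ‖w‖ ≤ 9 := by rw [div_le_iff₀ (by linarith)]; exact h2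
      linarith
    · rw [le_div_iff₀ (by linarith)]
      linarith
  have e : logDeriv Gamma w - Real.log ‖w‖ =
      (logDeriv Gamma w + ∑ k ∈ Finset.range N, (w + k)⁻¹ - Real.log N) -
      (∑ k ∈ Finset.range N, (w + k)⁻¹) + ((Real.log N : ℂ) - Real.log ‖w‖) := by ring
  rw [e]
  refine (norm_add_le _ _).trans ?_
  have := norm_sub_le (logDeriv Gamma w + ∑ k ∈ Finset.range N, (w + k)⁻¹ - Real.log N)
    (∑ k ∈ Finset.range N, (w + k)⁻¹)
  linarith

/-! ### Growth of xi -/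

/-- The entire function `s (s - 1) π ^ (-s / 2) Γ(s / 2) ζ(s)`. -/
noncomputable def xi (s : ℂ) : ℂ := 1 + s * (s - 1) * completedRiemannZeta₀ s

theorem differentiable_xi : Differentiable ℂ xi := by
  have := differentiable_completedZeta₀
  unfold xi
  fun_prop

theorem xi_one_sub (s : ℂ) : xi (1 - s) = xi s := by
  unfold xi
  rw [completedRiemannZeta₀_one_sub]
  ring

theorem xi_eq {s : ℂ} (hs : 0 < s.re) (hs1 : s ≠ 1) :
    xi s = s * (s - 1) * (Gammaℝ s * riemannZeta s) := by
  have h0 : s ≠ 0 := by rintro rfl; simp at hs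
  rw [riemannZeta_def_of_ne_zero h0, mul_div_cancel₀ _ (Gammaℝ_ne_zero_of_re_pos hs),
    completedRiemannZeta_eq, xi]
  have h1 : 1 - s ≠ 0 := sub_ne_zero.2 hs1.symm
  field_simp
  ring

theorem xi_ne_zero (hRH : RiemannHypothesis) {s : ℂ} (hs : 1 / 2 < s.re) : xi s ≠ 0 := by
  rcases eq_or_ne s 1 with rfl | hs1
  · simp [xi]
  have h0 : s ≠ 0 := by rintro rfl; norm_num at hs
  rw [xi_eq (by linarith) hs1]
  refine mul_ne_zero (mul_ne_zero h0 (sub_ne_zero.2 hs1))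
    (mul_ne_zero (Gammaℝ_ne_zero_of_re_pos (by linarith)) fun hz => ?_)
  refine hs.ne' (hRH s hz ?_ hs1)
  rintro ⟨n, rfl⟩
  have : ((-2 : ℂ) * (n + 1)).re = -2 * (n + 1) := by simp
  rw [this] at hs
  linarith [(Nat.cast_nonneg n : (0 : ℝ) ≤ n)]

theorem Gammaℝ_conj (s : ℂ) : Gammaℝ ((starRingEnd ℂ) s) = (starRingEnd ℂ) (Gammaℝ s) := by
  have h : (starRingEnd ℂ) s / 2 = (starRingEnd ℂ) (s / 2) := by
    rw [map_div₀, map_ofNat]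
  have h' : -(starRingEnd ℂ) s / 2 = (starRingEnd ℂ) (-s / 2) := by
    rw [map_div₀, map_ofNat, map_neg]
  rw [Gammaℝ_def, Gammaℝ_def, h, h', Gamma_conj, map_mul, cpow_conj, conj_ofReal]
  rw [arg_ofReal_of_nonneg Real.pi_pos.le]
  exact Real.pi_pos.ne

theorem norm_xi_conj {s : ℂ} (hs : 0 < s.re) (hs1 : s ≠ 1) :
    ‖xi ((starRingEnd ℂ) s)‖ = ‖xi s‖ := by
  have h1 : (starRingEnd ℂ) s ≠ 1 := (map_ne_one_iff _ (starRingEnd ℂ).injective).mpr hs1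
  rw [xi_eq (by simpa) h1, xi_eq hs hs1, riemannZeta_conj, Gammaℝ_conj, 
    ← norm_conj (s * (s - 1) * (Gammaℝ s * riemannZeta s))]
  simp only [map_mul, map_sub, map_one]

/-- On the strip, `x^(σ-1) ≤ x^(a-1) + x^(b-1)`, according to whether `x ≤ 1` or `x ≥ 1`. -/
theorem norm_mellin_le_of_strip {f : ℝ → ℂ} {a b : ℝ} (ha : MellinConvergent f a)
    (hb : MellinConvergent f b) {s : ℂ} (h1 : a ≤ s.re) (h2 : s.re ≤ b) :
    ‖mellin f s‖ ≤ (∫ x in Ioi (0 : ℝ), ‖(x : ℂ) ^ ((a : ℂ) - 1) • f x‖) +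
      ∫ x in Ioi (0 : ℝ), ‖(x : ℂ) ^ ((b : ℂ) - 1) • f x‖ := by
  have ia : IntegrableOn (fun x : ℝ => ‖(x : ℂ) ^ ((a : ℂ) - 1) • f x‖) (Ioi 0) := ha.norm
  have ib : IntegrableOn (fun x : ℝ => ‖(x : ℂ) ^ ((b : ℂ) - 1) • f x‖) (Ioi 0) := hb.norm
  rw [← integral_add ia ib]
  refine norm_integral_le_of_norm_le (ia.add ib) ?_
  refine (ae_restrict_iff' measurableSet_Ioi).2 (ae_of_all _ fun x hx => ?_)
  have hx : 0 < x := hx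
  simp only [norm_smul, norm_cpow_eq_rpow_re_of_pos hx]
  rw [← add_mul]
  gcongr
  simp only [sub_re, ofReal_re, one_re]
  rcases le_total 1 x with h | h
  · have := Real.rpow_le_rpow_of_exponent_le h (show s.re - 1 ≤ b - 1 by linarith)
    linarith [Real.rpow_nonneg hx.le (a - 1)]
  · have := Real.rpow_le_rpow_of_exponent_ge hx h (show a - 1 ≤ s.re - 1 by linarith)
    linarith [Real.rpow_nonneg hx.le (b - 1)]

/-- `completedRiemannZeta₀` is a Mellin transform that converges everywhere, hence is bounded on
vertical strips. This gives polynomial growth of `xi` there. -/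
theorem exists_norm_completedRiemannZeta₀_le (a b : ℝ) :
    ∃ C, 0 ≤ C ∧ ∀ s : ℂ, a ≤ s.re → s.re ≤ b → ‖completedRiemannZeta₀ s‖ ≤ C := by
  set P := HurwitzZeta.hurwitzEvenFEPair 0
  have conv : ∀ s : ℂ, MellinConvergent P.f_modif s := fun s =>
    (P.isStrongFEPair_toStrongFEPair.hasMellin s).1
  refine ⟨(∫ x in Ioi (0 : ℝ), ‖(x : ℂ) ^ (((a / 2 : ℝ) : ℂ) - 1) • P.f_modif x‖) +
    ∫ x in Ioi (0 : ℝ), ‖(x : ℂ) ^ (((b / 2 : ℝ) : ℂ) - 1) • P.f_modif x‖, by positivity,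
    fun s h1 h2 => ?_⟩
  · have e : completedRiemannZeta₀ s = mellin P.f_modif (s / 2) / 2 := rfl
    rw [e, norm_div, norm_ofNat]
    refine (div_le_self (norm_nonneg _) one_le_two).trans ?_
    refine norm_mellin_le_of_strip (a := a / 2) (b := b / 2) (conv _) (conv _) ?_ ?_
    · rw [show (s / 2).re = s.re / 2 by simp]; linarith
    · rw [show (s / 2).re = s.re / 2 by simp]; linarith

theorem exists_norm_xi_le (a b : ℝ) :
    ∃ C, 1 ≤ C ∧ ∀ s : ℂ, a ≤ s.re → s.re ≤ b → ‖xi s‖ ≤ C * (1 + ‖s‖) ^ 2 := by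
  obtain ⟨C, hC, h⟩ := exists_norm_completedRiemannZeta₀_le a b
  refine ⟨1 + C, by linarith, fun s h1 h2 => ?_⟩
  unfold xi
  refine (norm_add_le _ _).trans ?_
  rw [norm_one, norm_mul, norm_mul]
  have h3 := h s h1 h2
  have h4 : ‖s - 1‖ ≤ ‖s‖ + 1 := by simpa using norm_sub_le s 1
  have h5 : ‖s‖ * ‖s - 1‖ * ‖completedRiemannZeta₀ s‖ ≤ ‖s‖ * (‖s‖ + 1) * C := by gcongr
  nlinarith [norm_nonneg s, mul_nonneg hC (norm_nonneg s)]

theorem norm_riemannZeta_sub_one_le {s : ℂ} (hs : 2 ≤ s.re) : ‖riemannZeta s - 1‖ ≤ 2 / 3 := by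
  have hsum : HasSum (fun n : ℕ => 1 / (n : ℝ) ^ 2) (Real.pi ^ 2 / 6) := hasSum_zeta_two
  rw [zeta_eq_tsum_one_div_nat_add_one_cpow (by linarith)]
  have hs1 : Summable fun n : ℕ => 1 / ((n : ℂ) + 1) ^ s := by
    have := (summable_nat_add_iff 1).2 (Complex.summable_one_div_nat_cpow.2
      (show 1 < s.re by linarith))
    simpa using this
  rw [hs1.tsum_eq_zero_add]
  simp only [Nat.cast_zero, zero_add, one_cpow, div_one, add_sub_cancel_left]
  have h2 : HasSum (fun n : ℕ => 1 / ((n + 2 : ℕ) : ℝ) ^ 2) (Real.pi ^ 2 / 6 - 1) := by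
    have := (hasSum_nat_add_iff' 2).2 hsum
    simpa [Finset.sum_range_succ] using this
  refine (tsum_of_norm_bounded h2 fun n => ?_).trans ?_
  · rw [norm_div, norm_one, show ((n + 1 : ℕ) : ℂ) + 1 = ((n + 2 : ℕ) : ℂ) by push_cast; ring,
      norm_natCast_cpow_of_pos (by omega)]
    gcongr
    rw [← Real.rpow_natCast]
    exact Real.rpow_le_rpow_of_exponent_le (by norm_cast; omega) (by simpa using hs)
  · have := Real.pi_lt_d2
    nlinarith [Real.pi_gt_three]

theorem norm_riemannZeta_ge {s : ℂ} (hs : 2 ≤ s.re) : 1 / 3 ≤ ‖riemannZeta s‖ := by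
  have h1 := norm_riemannZeta_sub_one_le hs
  have h2 := norm_sub_norm_le 1 (riemannZeta s)
  rw [norm_one, norm_sub_rev] at h2
  linarith

theorem norm_riemannZeta_le_two {s : ℂ} (hs : 2 ≤ s.re) : ‖riemannZeta s‖ ≤ 2 := by
  have h1 := norm_riemannZeta_sub_one_le hs
  have h2 := norm_sub_norm_le (riemannZeta s) 1
  rw [norm_one] at h2
  linarith

theorem norm_Gammaℝ (s : ℂ) : ‖Gammaℝ s‖ = Real.pi ^ (-s.re / 2) * ‖Gamma (s / 2)‖ := by
  rw [Gammaℝ_def, norm_mul, norm_cpow_eq_rpow_re_of_pos Real.pi_pos]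
  simp

/-- Anchor for the lower bound in the strip: the disc of radius `5/2` about `3 + iy` just touches
the critical line, so `xi` has no zeros in it under the Riemann hypothesis. -/
theorem norm_xi_three_add_ge (y : ℝ) : Real.exp (-(2 + |y|)) ≤ ‖xi (3 + y * I)‖ := by
  have hre : (3 + y * I : ℂ).re = 3 := by simp
  rw [xi_eq (by rw [hre]; norm_num) (fun h => by rw [h] at hre; norm_num at hre), norm_mul,
    norm_mul, norm_mul, norm_Gammaℝ, hre]
  have h1 : 3 ≤ ‖(3 + y * I : ℂ)‖ := by simpa using abs_re_le_norm (3 + y * I : ℂ)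
  have h2 : 2 ≤ ‖(3 + y * I : ℂ) - 1‖ := by
    have := abs_re_le_norm ((3 + y * I : ℂ) - 1)
    norm_num at this
    exact this
  have h3 := norm_riemannZeta_ge (s := 3 + y * I) (by rw [hre]; norm_num)
  have h4 : (1 / 2) * Real.exp (-|y|) ≤ ‖Gamma ((3 + y * I) / 2)‖ := by
    have e : ((3 + y * I) / 2 : ℂ) = (1 / 2 + (y / 2 : ℝ) * I) + 1 := by push_cast; ring
    rw [e, Gamma_add_one _ (fun h => by have := congrArg re h; norm_num at this), norm_mul]
    have g1 : 1 / 2 ≤ ‖(1 / 2 + (y / 2 : ℝ) * I : ℂ)‖ := by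
      have := abs_re_le_norm (1 / 2 + (y / 2 : ℝ) * I : ℂ)
      norm_num at this ⊢
      exact this
    gcongr
    refine (sq_le_sq₀ (Real.exp_pos _).le (norm_nonneg _)).1 ?_
    refine le_trans ?_ (norm_Gamma_half_add_sq_ge (y / 2))
    rw [← Real.exp_nat_mul, abs_div, abs_two]
    gcongr
    push_cast
    nlinarith [Real.pi_lt_four, abs_nonneg y]
  have h5 : Real.exp (-2) ≤ Real.pi ^ (-3 / 2 : ℝ) := by
    rw [Real.rpow_def_of_pos Real.pi_pos]
    gcongr
    have : Real.log Real.pi ≤ Real.log (Real.exp 1 ^ (4 / 3 : ℝ)) := by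
      gcongr
      rw [← Real.exp_mul]
      have := Real.quadratic_le_exp_of_nonneg (show (0 : ℝ) ≤ 1 * (4 / 3) by norm_num)
      have h6 : (3.2 : ℝ) ≤ Real.exp (1 * (4 / 3)) := by
        refine le_trans ?_ (Real.sum_le_exp_of_nonneg (show (0 : ℝ) ≤ 1 * (4 / 3) by norm_num) 4)
        norm_num [Finset.sum_range_succ, Nat.factorial]
      linarith [Real.pi_lt_d2]
    rw [Real.log_rpow (Real.exp_pos _), Real.log_exp] at this
    linarith
  rw [neg_add, Real.exp_add]
  calc Real.exp (-2) * Real.exp (-|y|)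
      = 3 * 2 * (Real.exp (-2) * (1 / 2 * Real.exp (-|y|)) * (1 / 3)) := by ring
    _ ≤ _ := by gcongr

theorem one_add_sq_le_exp {x : ℝ} (hx : 0 ≤ x) : (1 + x) ^ 2 ≤ Real.exp (2 * x) := by
  rw [two_mul, Real.exp_add, sq]
  have := Real.add_one_le_exp x
  gcongr <;> linarith

theorem exists_norm_xi_ge (hRH : RiemannHypothesis) {h : ℝ} (hh : 0 < h) :
    ∃ K, 0 ≤ K ∧ ∀ s : ℂ, 1 / 2 + h ≤ s.re → s.re ≤ 3 →
      Real.exp (-(K * (1 + |s.im|))) ≤ ‖xi s‖ := by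
  obtain ⟨C, hC, hxi⟩ := exists_norm_xi_le (1 / 2) 6
  refine ⟨2 + 5 * (C + 18) / h, by positivity, fun s h1 h2 => ?_⟩
  set y := s.im
  -- Upper bound `C + 2(8 + |y|)` for `log ‖xi‖` on the disc, plus `2 + |y|` for the lower bound at
  -- its centre.
  set k := C + 18 + 3 * |y| with hk
  have hkpos : 0 < k := by positivity
  have hball : ∀ z ∈ ball (3 + y * I : ℂ) (5 / 2), 1 / 2 < z.re ∧ z.re ≤ 6 ∧ ‖z‖ ≤ 8 + |y| := by
    intro z hz
    rw [mem_ball, dist_eq_norm] at hz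
    have g1 := abs_lt.1 ((abs_re_le_norm _).trans_lt hz)
    simp at g1
    refine ⟨by linarith, by linarith, ?_⟩
    have g2 := norm_sub_norm_le z (3 + y * I : ℂ)
    have g3 : ‖(3 + y * I : ℂ)‖ ≤ 3 + |y| := (norm_add_le _ _).trans (by simp)
    linarith
  have hc := norm_xi_three_add_ge y
  have key := norm_ge_of_ball (f := xi) (c := 3 + y * I) (R := 5 / 2) (k := k) (z := s)
    (by norm_num) hkpos differentiable_xi.differentiableOn
    (fun z hz => xi_ne_zero hRH (hball z hz).1) (fun z hz => by
      obtain ⟨g1, g2, g3⟩ := hball z hz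
      calc ‖xi z‖ ≤ C * (1 + ‖z‖) ^ 2 := hxi z g1.le g2
        _ ≤ Real.exp C * Real.exp (2 * ‖z‖) := by
          gcongr
          · linarith [Real.add_one_le_exp C]
          · exact one_add_sq_le_exp (norm_nonneg z)
        _ ≤ Real.exp k * Real.exp (-(2 + |y|)) := by
          rw [← Real.exp_add, ← Real.exp_add]
          exact Real.exp_le_exp.2 (by linarith)
        _ ≤ _ := by gcongr)
  have e : s - (3 + y * I) = ((s.re - 3 : ℝ) : ℂ) := by
    apply Complex.ext <;> simp [y]
  have er : ‖s - (3 + y * I)‖ = 3 - s.re := by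
    rw [e, norm_real, Real.norm_eq_abs, abs_of_nonpos (by linarith)]
    ring
  have hs : s ∈ ball (3 + y * I : ℂ) (5 / 2) := by
    rw [mem_ball, dist_eq_norm, er]
    linarith
  refine le_trans ?_ (key hs)
  rw [er]
  refine le_trans ?_ (mul_le_mul_of_nonneg_right hc (Real.exp_pos _).le)
  rw [← Real.exp_add]
  gcongr
  have g1 : 2 * k * (3 - s.re) / (5 / 2 - (3 - s.re)) ≤ 5 * k / h := by
    rw [div_le_div_iff₀ (by linarith) hh]
    calc 2 * k * (3 - s.re) * h ≤ 2 * k * (5 / 2) * h := by gcongr; linarith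
      _ = 5 * k * h := by ring
      _ ≤ _ := by gcongr; linarith
  have g2 : 5 * k / h ≤ 5 * (C + 18) / h * (1 + |y|) := by
    rw [div_mul_eq_mul_div]
    refine div_le_div_of_nonneg_right ?_ hh.le
    nlinarith [abs_nonneg y]
  nlinarith [abs_nonneg y]

/-- To the right of the strip, the Beta-integral bound controls the Gamma factors. The constant need
not be `1`: it only serves as an a priori bound for Phragmén–Lindelöf. -/
theorem norm_xi_le_const_mul_norm_xi_add {h : ℝ} (hh : 0 < h) {s : ℂ} (hs : 2 ≤ s.re) :
    ‖xi s‖ ≤ 6 * (Real.pi ^ h / Real.Gamma (h + 1)) * ‖xi (s + (2 * h : ℝ))‖ := by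
  have hne : ∀ z : ℂ, 2 ≤ z.re → z ≠ 1 := fun z hz h => by rw [h] at hz; norm_num at hz
  have hre : (s + (2 * h : ℝ)).re = s.re + 2 * h := by simp
  have hs2 : 2 ≤ (s + (2 * h : ℝ)).re := by rw [hre]; linarith
  rw [xi_eq (by linarith) (hne s hs), xi_eq (by linarith) (hne _ hs2)]
  simp only [norm_mul, norm_Gammaℝ, hre]
  have hmono : ∀ z : ℂ, 0 ≤ z.re → ‖z‖ ≤ ‖z + (2 * h : ℝ)‖ := fun z hz => by
    refine (sq_le_sq₀ (norm_nonneg _) (norm_nonneg _)).1 ?_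
    rw [Complex.sq_norm, Complex.sq_norm, normSq_apply, normSq_apply]
    simp
    nlinarith
  have h1 := hmono s (by linarith)
  have h2 := hmono (s - 1) (by simp; linarith)
  rw [show s - 1 + (2 * h : ℝ) = s + (2 * h : ℝ) - 1 by ring] at h2
  have h3 := norm_riemannZeta_le_two hs
  have h4 := norm_riemannZeta_ge hs2
  have h5 := norm_Gamma_le_norm_Gamma_add (w := s / 2) (h := h) (by simp; linarith) hh
  rw [show s / 2 + h = (s + (2 * h : ℝ)) / 2 by push_cast; ring] at h5
  have h6 : Real.pi ^ (-s.re / 2) = Real.pi ^ h * Real.pi ^ (-(s.re + 2 * h) / 2) := by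
    rw [← Real.rpow_add Real.pi_pos]
    ring_nf
  have hG := Real.Gamma_pos_of_pos (show 0 < h + 1 by linarith)
  rw [h6]
  calc ‖s‖ * ‖s - 1‖ * (Real.pi ^ h * Real.pi ^ (-(s.re + 2 * h) / 2) * ‖Gamma (s / 2)‖ *
        ‖riemannZeta s‖)
      ≤ ‖s + (2 * h : ℝ)‖ * ‖s + (2 * h : ℝ) - 1‖ * (Real.pi ^ h *
        Real.pi ^ (-(s.re + 2 * h) / 2) * (‖Gamma ((s + (2 * h : ℝ)) / 2)‖ / Real.Gamma (h + 1)) *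
        (6 * ‖riemannZeta (s + (2 * h : ℝ))‖)) := by
        gcongr
        linarith
    _ = _ := by ring

/-! ### Monotonicity of |xi| under the Riemann hypothesis -/

/-- The bound used in the Phragmén–Lindelöf argument. -/
theorem norm_xi_sub_div_xi_add_le_one (hRH : RiemannHypothesis) {h : ℝ} (hh : 0 < h)
    (hh' : h ≤ 1 / 4) {z : ℂ} (hz : 0 ≤ z.re) : ‖xi (1 / 2 + z - h) / xi (1 / 2 + z + h)‖ ≤ 1 := by
  obtain ⟨K, hK, hlow⟩ := exists_norm_xi_ge hRH hh
  obtain ⟨C, hC, hup⟩ := exists_norm_xi_le 0 3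
  set D := 6 * (Real.pi ^ h / Real.Gamma (h + 1))
  have hne : ∀ w : ℂ, 0 ≤ w.re → xi (1 / 2 + w + h) ≠ 0 := fun w hw =>
    xi_ne_zero hRH (by simp; linarith)
  have hD : ∀ w : ℂ, 2 ≤ w.re → ‖xi (1 / 2 + w - h) / xi (1 / 2 + w + h)‖ ≤ D := by
    intro w hw
    have := norm_xi_le_const_mul_norm_xi_add hh (s := 1 / 2 + w - h) (by simp; linarith)
    rw [show (1 / 2 + w - h + (2 * h : ℝ) : ℂ) = 1 / 2 + w + h by push_cast; ring] at this
    rw [norm_div, div_le_iff₀ (norm_pos_iff.2 (hne w (by linarith)))]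
    exact this
  have hD0 : 0 ≤ D := (norm_nonneg _).trans (hD 2 (by simp))
  have hS : ∀ w : ℂ, 0 ≤ w.re → w.re ≤ 2 → ‖xi (1 / 2 + w - h) / xi (1 / 2 + w + h)‖ ≤
      C * Real.exp (2 + K) * Real.exp ((2 + K) * ‖w‖) := by
    intro w hw hw2
    have h1 := hup (1 / 2 + w - h) (by simp; linarith) (by simp; linarith)
    have h2 := hlow (1 / 2 + w + h) (by simp; linarith) (by simp; linarith)
    have h3 : ‖(1 / 2 + w - h : ℂ)‖ ≤ 1 + ‖w‖ := by
      rw [show (1 / 2 + w - h : ℂ) = ((1 / 2 - h : ℝ) : ℂ) + w by push_cast; ring]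
      refine (norm_add_le _ _).trans ?_
      rw [norm_real, Real.norm_of_nonneg (by linarith)]
      linarith
    have h4 : |(1 / 2 + w + h : ℂ).im| ≤ ‖w‖ := by simpa using abs_im_le_norm w
    rw [norm_div, div_le_iff₀ (norm_pos_iff.2 (hne w hw))]
    calc _ ≤ C * (1 + ‖(1 / 2 + w - h : ℂ)‖) ^ 2 := h1
      _ ≤ C * Real.exp (2 * (1 + ‖w‖)) := by
        gcongr
        refine (one_add_sq_le_exp (norm_nonneg _)).trans ?_
        gcongr
      _ ≤ C * (Real.exp ((2 + K) * (1 + ‖w‖)) *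
          Real.exp (-(K * (1 + |(1 / 2 + w + h : ℂ).im|)))) := by
        rw [← Real.exp_add]
        gcongr
        nlinarith
      _ ≤ C * (Real.exp ((2 + K) * (1 + ‖w‖)) * ‖xi (1 / 2 + w + h)‖) := by gcongr
      _ = _ := by rw [mul_add (2 + K), mul_one, Real.exp_add]; ring
  -- The quotient has growth of order one in the half-plane and is bounded on the far positive real
  -- axis. On the imaginary axis the two arguments are mirror images in the critical line, so the
  -- moduli agree by the functional equation and conjugation.
  refine PhragmenLindelof.right_half_plane_of_bounded_on_real (C := 1)
    (f := fun w => xi (1 / 2 + w - h) / xi (1 / 2 + w + h)) ?_ ?_ ?_ ?_ hz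
  · refine DifferentiableOn.diffContOnCl fun w hw => ?_
    have hw' : 0 ≤ w.re := by
      rw [closure_setOfPred_lt_re] at hw
      exact hw
    have h1 : DifferentiableAt ℂ (fun w : ℂ => xi (1 / 2 + w - h)) w :=
      (differentiable_xi _).comp w (by fun_prop)
    have h2 : DifferentiableAt ℂ (fun w : ℂ => xi (1 / 2 + w + h)) w :=
      (differentiable_xi _).comp w (by fun_prop)
    exact (h1.div h2 (hne w hw')).differentiableWithinAt
  · refine ⟨1, by norm_num, 2 + K, Asymptotics.IsBigO.of_bound (C * Real.exp (2 + K) + D) ?_⟩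
    refine eventually_inf_principal.2 (Eventually.of_forall fun w hw => ?_)
    have hw : 0 < w.re := hw
    rw [Real.rpow_one, Real.norm_of_nonneg (Real.exp_pos _).le, add_mul]
    have h1 : 1 ≤ Real.exp ((2 + K) * ‖w‖) := Real.one_le_exp (by positivity)
    have h0 : 0 ≤ C * Real.exp (2 + K) * Real.exp ((2 + K) * ‖w‖) := by positivity
    rcases le_total w.re 2 with h2 | h2
    · refine (hS w hw.le h2).trans ?_
      nlinarith
    · refine (hD w h2).trans ?_
      nlinarith
  · refine ⟨D, ?_⟩
    rw [eventually_map]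
    filter_upwards [eventually_ge_atTop 2] with x hx
    exact hD x (by simpa)
  · intro x
    have hre : (1 / 2 + x * I + h : ℂ).re = 1 / 2 + h := by simp
    have e : (1 / 2 + x * I - h : ℂ) = 1 - (starRingEnd ℂ) (1 / 2 + x * I + h) := by
      rw [map_add, map_add, map_mul, conj_ofReal, conj_I, map_div₀, map_one, map_ofNat, conj_ofReal]
      ring
    rw [norm_div, e, xi_one_sub, norm_xi_conj (by rw [hre]; linarith)
      (fun h' => by rw [h', one_re] at hre; linarith)]
    exact div_self_le_one _

theorem norm_xi_le_norm_xi_add (hRH : RiemannHypothesis) {s : ℂ} (hs : 1 / 2 ≤ s.re) {r : ℝ}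
    (hr : 0 < r) (hr' : r ≤ 1 / 2) : ‖xi s‖ ≤ ‖xi (s + r)‖ := by
  have := norm_xi_sub_div_xi_add_le_one hRH (h := r / 2) (z := s - 1 / 2 + (r / 2 : ℝ))
    (by linarith) (by linarith) (by simp; linarith)
  rw [show (1 / 2 + (s - 1 / 2 + (r / 2 : ℝ)) - (r / 2 : ℝ) : ℂ) = s by ring,
    show (1 / 2 + (s - 1 / 2 + (r / 2 : ℝ)) + (r / 2 : ℝ) : ℂ) = s + r by push_cast; ring,
    norm_div, div_le_one (norm_pos_iff.2 (xi_ne_zero hRH (by simp; linarith)))] at this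
  exact this

/-- Under the Riemann hypothesis the logarithmic derivative of `xi` has nonnegative real part to
the right of the critical line. -/
theorem re_logDeriv_xi_nonneg (hRH : RiemannHypothesis) {s : ℂ} (hs : 1 / 2 < s.re) :
    0 ≤ (logDeriv xi s).re := by
  have hd : HasDerivAt (fun r : ℝ => xi (s + r)) (deriv xi s) 0 := by
    have h1 : HasDerivAt (fun z : ℂ => xi (s + z)) (deriv xi s) ((0 : ℝ) : ℂ) := by
      have := (differentiable_xi (s + ((0 : ℝ) : ℂ))).hasDerivAt.comp_const_add s ((0 : ℝ) : ℂ)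
      simpa using this
    exact h1.comp_ofReal
  -- The right-hand difference quotients of `‖xi (s + r)‖ ^ 2` are nonnegative by monotonicity;
  -- their limit has the sign of `Re (xi' / xi)`.
  have h2 := hd.norm_sq
  have h3 : 0 ≤ 2 * inner ℝ (xi (s + (0 : ℝ))) (deriv xi s) := by
    refine ge_of_tendsto ((hasDerivAt_iff_tendsto_slope.1 h2).mono_left
      (nhdsGT_le_nhdsNE 0)) ?_
    filter_upwards [Ioc_mem_nhdsGT (show (0 : ℝ) < 1 / 2 by norm_num)] with r hr
    rw [slope_def_field]
    refine div_nonneg (sub_nonneg.2 ?_) (by linarith [hr.1])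
    have := norm_xi_le_norm_xi_add hRH hs.le hr.1 hr.2
    simp only [ofReal_zero, add_zero]
    gcongr
  rw [ofReal_zero, add_zero, Complex.inner] at h3
  have h0 := xi_ne_zero hRH hs
  rw [logDeriv_apply, div_eq_mul_inv, inv_def, ← mul_assoc, mul_comm (deriv xi s), re_mul_ofReal]
  refine mul_nonneg ?_ (inv_nonneg.2 (normSq_nonneg _))
  rw [mul_comm] at h3
  first
    | linarith
    | (rw [mul_comm]; linarith)

/-! ### The logarithmic derivative of zeta -/

theorem differentiableAt_Gammaℝ {s : ℂ} (hs : 0 < s.re) : DifferentiableAt ℂ Gammaℝ s := by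
  have := (differentiable_Gammaℝ_inv s).fun_inv (inv_ne_zero (Gammaℝ_ne_zero_of_re_pos hs))
  simpa using this

theorem logDeriv_Gammaℝ {s : ℂ} (hs : 0 < s.re) :
    logDeriv Gammaℝ s = -(Real.log Real.pi / 2 : ℝ) + logDeriv Gamma (s / 2) / 2 := by
  have hre : 0 < (s / 2).re := by simpa using hs
  have h1 : DifferentiableAt ℂ Gamma (s / 2) := differentiableAt_Gamma _ fun m h => by
    rw [h] at hre
    simp at hre
    linarith [(Nat.cast_nonneg m : (0 : ℝ) ≤ m)]
  have h2 : HasDerivAt (fun z : ℂ => Gamma (z / 2)) (deriv Gamma (s / 2) * (1 / 2)) s :=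
    h1.hasDerivAt.comp s ((hasDerivAt_id s).div_const 2)
  have h3 : HasDerivAt (fun z : ℂ => (Real.pi : ℂ) ^ (-z / 2))
      ((Real.pi : ℂ) ^ (-s / 2) * log Real.pi * (-1 / 2)) s :=
    HasDerivAt.const_cpow (((hasDerivAt_id s).fun_neg).div_const 2)
      (Or.inl (ofReal_ne_zero.2 Real.pi_ne_zero))
  have hp : (Real.pi : ℂ) ^ (-s / 2) ≠ 0 := by
    simp [cpow_eq_zero_iff, Real.pi_ne_zero]
  have e : Gammaℝ = fun z : ℂ => (Real.pi : ℂ) ^ (-z / 2) * Gamma (z / 2) := funext Gammaℝ_def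
  rw [e, logDeriv_mul (f := fun z : ℂ => (Real.pi : ℂ) ^ (-z / 2)) (g := fun z => Gamma (z / 2))
    s hp
    (Gamma_ne_zero_of_re_pos hre) h3.differentiableAt h2.differentiableAt,
    logDeriv_apply, logDeriv_apply, logDeriv_apply, h3.deriv, h2.deriv]
  have hG := Gamma_ne_zero_of_re_pos hre
  push_cast
  rw [ofReal_log Real.pi_pos.le]
  field_simp

/-- The contribution of the Gamma factor and of the polynomial factor to `xi' / xi`. -/
noncomputable def gammaPart (s : ℂ) : ℂ := s⁻¹ + (s - 1)⁻¹ + logDeriv Gammaℝ s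

theorem logDeriv_xi_eq {s : ℂ} (hs : 0 < s.re) (hs1 : s ≠ 1) (hz : riemannZeta s ≠ 0) :
    logDeriv xi s = gammaPart s + logDeriv riemannZeta s := by
  have h0 : s ≠ 0 := by rintro rfl; simp at hs
  have h1 : s - 1 ≠ 0 := sub_ne_zero.2 hs1
  have hG := Gammaℝ_ne_zero_of_re_pos hs
  have hdG := differentiableAt_Gammaℝ hs
  have hdz := differentiableAt_riemannZeta hs1
  have hev : xi =ᶠ[𝓝 s] fun z => z * (z - 1) * (Gammaℝ z * riemannZeta z) := by
    filter_upwards [(isOpen_lt continuous_const continuous_re).mem_nhds hs,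
      isOpen_ne.mem_nhds hs1] with z hz1 hz2
    exact xi_eq hz1 hz2
  have hd1 : DifferentiableAt ℂ (fun z : ℂ => z) s := differentiableAt_id
  have hd2 : DifferentiableAt ℂ (fun z : ℂ => z - 1) s := by fun_prop
  rw [logDeriv_apply, hev.deriv_eq, hev.eq_of_nhds, ← logDeriv_apply,
    logDeriv_mul (f := fun z => z * (z - 1)) (g := fun z => Gammaℝ z * riemannZeta z) s
      (mul_ne_zero h0 h1) (mul_ne_zero hG hz)
      (hd1.mul hd2) (hdG.mul hdz), logDeriv_mul
      (f := fun z => z) (g := fun z => z - 1) s h0 h1 hd1 hd2,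
    logDeriv_mul (f := Gammaℝ) (g := riemannZeta) s hG hz hdG hdz]
  have e1 : logDeriv (fun z : ℂ => z) s = s⁻¹ := by simp [logDeriv_apply]
  have e2 : logDeriv (fun z : ℂ => z - 1) s = (s - 1)⁻¹ := by
    simp [logDeriv_apply]
  rw [e1, e2, gammaPart]
  ring

theorem norm_gammaPart_sub_le {s : ℂ} (h1 : 1 / 2 ≤ s.re) (h2 : s.re ≤ 3) (h3 : 2 ≤ |s.im|) :
    ‖gammaPart s - (Real.log |s.im| / 2 : ℝ)‖ ≤ 25 := by
  have hs : 2 ≤ ‖s‖ := h3.trans (abs_im_le_norm s)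
  have hs1 : 2 ≤ ‖s - 1‖ := by
    have := abs_im_le_norm (s - 1)
    simp at this
    linarith
  have a1 : ‖s⁻¹‖ ≤ 1 := by rw [norm_inv]; exact inv_le_one_of_one_le₀ (by linarith)
  have a2 : ‖(s - 1)⁻¹‖ ≤ 1 := by rw [norm_inv]; exact inv_le_one_of_one_le₀ (by linarith)
  have hn : ‖s / 2‖ = ‖s‖ / 2 := by simp
  have a3 := norm_logDeriv_Gamma_sub_log_norm_le (w := s / 2) (by simp; linarith)
    (by rw [hn]; linarith)
  have a4 : |Real.log Real.pi| ≤ 2 := by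
    rw [abs_of_nonneg (Real.log_nonneg (by linarith [Real.pi_gt_three]))]
    rw [Real.log_le_iff_le_exp Real.pi_pos]
    have : Real.exp 1 ≤ Real.exp 2 := Real.exp_le_exp.2 (by norm_num)
    have := Real.add_one_le_exp 1
    have h5 : (2 : ℝ) * 2 ≤ Real.exp 1 * Real.exp 1 := by gcongr <;> linarith
    rw [← Real.exp_add] at h5
    norm_num at h5
    linarith [Real.pi_lt_four]
  have hup : ‖s‖ / 2 ≤ 2 * |s.im| := by
    have := norm_le_abs_re_add_abs_im s
    rw [abs_of_nonneg (show 0 ≤ s.re by linarith)] at this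
    linarith
  have hlo : |s.im| / 2 ≤ ‖s‖ / 2 := by linarith [abs_im_le_norm s]
  have a5 : |Real.log ‖s / 2‖ - Real.log (|s.im|)| ≤ 1 := by
    rw [hn]
    have u1 := Real.log_le_log (by linarith) hup
    have u2 := Real.log_le_log (by linarith) hlo
    rw [Real.log_mul (by norm_num) (by linarith)] at u1
    rw [Real.log_div (by linarith) (by norm_num)] at u2
    have := Real.log_two_lt_d9
    rw [abs_le]
    constructor <;> linarith
  rw [gammaPart, logDeriv_Gammaℝ (by linarith)]
  have e : s⁻¹ + (s - 1)⁻¹ + (-(Real.log Real.pi / 2 : ℝ) + logDeriv Gamma (s / 2) / 2) -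
      (Real.log |s.im| / 2 : ℝ) = s⁻¹ + (s - 1)⁻¹ + ((-(Real.log Real.pi / 2) +
      (Real.log ‖s / 2‖ - Real.log |s.im|) / 2 : ℝ) : ℂ) +
      (logDeriv Gamma (s / 2) - Real.log ‖s / 2‖) / 2 := by
    push_cast
    ring
  rw [e]
  have a6 : |-(Real.log Real.pi / 2) + (Real.log ‖s / 2‖ - Real.log (|s.im|)) / 2| ≤ 2 := by
    rw [abs_le] at *
    constructor <;> linarith [a4.1, a4.2, a5.1, a5.2]
  rw [← Real.norm_eq_abs, ← norm_real] at a6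
  have a7 : ‖(logDeriv Gamma (s / 2) - Real.log ‖s / 2‖) / 2‖ ≤ 20 := by
    rw [norm_div, norm_ofNat]
    linarith
  refine (norm_add_le _ _).trans ?_
  have := norm_add₃_le (a := s⁻¹) (b := (s - 1)⁻¹)
    (c := ((-(Real.log Real.pi / 2) + (Real.log ‖s / 2‖ - Real.log |s.im|) / 2 : ℝ) : ℂ))
  linarith

theorem exists_norm_riemannZeta_le {σ : ℝ} (hσ : 1 < σ) :
    ∃ C, 1 ≤ C ∧ ∀ s : ℂ, σ ≤ s.re → ‖riemannZeta s‖ ≤ C := by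
  have hs : Summable fun n : ℕ => 1 / (n : ℝ) ^ σ := Real.summable_one_div_nat_rpow.2 hσ
  refine ⟨1 + ∑' n : ℕ, 1 / (n : ℝ) ^ σ, ?_, fun s h => ?_⟩
  · have : 0 ≤ ∑' n : ℕ, 1 / (n : ℝ) ^ σ := tsum_nonneg fun n => by positivity
    linarith
  rw [zeta_eq_tsum_one_div_nat_cpow (by linarith)]
  refine (tsum_of_norm_bounded hs.hasSum fun n => ?_).trans (by linarith)
  rcases Nat.eq_zero_or_pos n with rfl | hn
  · rw [Nat.cast_zero, zero_cpow (fun h0 => by rw [h0] at h; simp at h; linarith)]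
    simp [Real.zero_rpow (by linarith : σ ≠ 0)]
  · rw [norm_div, norm_one, norm_natCast_cpow_of_pos hn]
    gcongr
    exact_mod_cast hn

/-- The von Mangoldt Dirichlet series is dominated termwise by its value at `σ`. -/
theorem exists_norm_logDeriv_riemannZeta_le {σ : ℝ} (hσ : 1 < σ) :
    ∃ B, 0 ≤ B ∧ ∀ s : ℂ, σ ≤ s.re → ‖logDeriv riemannZeta s‖ ≤ B := by
  have hs := (ArithmeticFunction.LSeriesSummable_vonMangoldt (s := σ) (by simpa)).norm
  refine ⟨∑' n, ‖LSeries.term (fun n => (ArithmeticFunction.vonMangoldt n : ℂ)) (σ : ℂ) n‖,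
    tsum_nonneg fun n => norm_nonneg _, fun s h => ?_⟩
  have h1 := ArithmeticFunction.LSeries_vonMangoldt_eq_deriv_riemannZeta_div
    (show 1 < s.re by linarith)
  rw [logDeriv_apply, ← norm_neg, ← neg_div, ← h1]
  exact tsum_of_norm_bounded hs.hasSum fun n => LSeries.norm_term_le_of_re_le_re _ (by simpa) n

theorem riemannZeta_ne_zero_of_half_lt_re (hRH : RiemannHypothesis) {s : ℂ} (hs : 1 / 2 < s.re)
    (hs1 : s ≠ 1) :
    riemannZeta s ≠ 0 := by
  intro hz
  refine xi_ne_zero hRH hs ?_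
  rw [xi_eq (by linarith) hs1, hz, mul_zero, mul_zero]

/-- Positivity of `Re (xi' / xi)` minus the Gamma contribution, which is `log |Im s| / 2 + O(1)`.
The factor `1/2` decides the final constant. -/
theorem neg_le_re_logDeriv_riemannZeta (hRH : RiemannHypothesis) {s : ℂ} (h1 : 1 / 2 < s.re)
    (h2 : s.re ≤ 3)
    (h3 : 2 ≤ |s.im|) : -(Real.log |s.im| / 2 + 25) ≤ (logDeriv riemannZeta s).re := by
  have hs1 : s ≠ 1 := by rintro rfl; norm_num at h3
  have e := logDeriv_xi_eq (by linarith) hs1 (riemannZeta_ne_zero_of_half_lt_re hRH h1 hs1)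
  have h4 := re_logDeriv_xi_nonneg hRH h1
  have h5 := (abs_re_le_norm _).trans (norm_gammaPart_sub_le h1.le h2 h3)
  rw [e, add_re] at h4
  rw [sub_re, ofReal_re] at h5
  linarith [(abs_le.1 h5).2]

/-- A crude bound for the horizontal sides of the box, where it is divided by `Y ^ 2`; the loss of
`1 / ε` is harmless. -/
theorem exists_norm_logDeriv_riemannZeta_le_div (hRH : RiemannHypothesis) :
    ∃ C, 0 ≤ C ∧ ∀ (ε : ℝ) (s : ℂ), 0 < ε → ε ≤ 1 → 1 / 2 + ε ≤ s.re → s.re ≤ 2 →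
      2 ≤ |s.im| → ‖logDeriv riemannZeta s‖ ≤ (C + 2 * Real.log |s.im|) / ε := by
  obtain ⟨B, hB0, hB⟩ := exists_norm_logDeriv_riemannZeta_le (show (1 : ℝ) < 2 by norm_num)
  refine ⟨103 + 3 * B, by positivity, fun ε s hε hε1 h1 h2 h3 => ?_⟩
  set y := s.im
  set c : ℂ := 2 + y * I with hc
  have cre : c.re = 2 := by simp [hc]
  have cim : c.im = y := by simp [hc]
  have hne : ∀ z : ℂ, 2 ≤ |z.im| → z ≠ 1 := fun z hz h => by rw [h] at hz; norm_num at hz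
  have hlog : 0 ≤ Real.log |y| := Real.log_nonneg (by linarith)
  have hHc : ‖logDeriv xi c‖ ≤ B + Real.log |y| / 2 + 25 := by
    rw [logDeriv_xi_eq (by rw [cre]; norm_num) (hne c (by rwa [cim]))
      (riemannZeta_ne_zero_of_half_lt_re hRH (by rw [cre]; norm_num) (hne c (by rwa [cim])))]
    have g1 := norm_gammaPart_sub_le (s := c) (by rw [cre]; norm_num) (by rw [cre]; norm_num)
      (by rwa [cim])
    have g2 := hB c cre.ge
    have g3 := norm_le_norm_sub_add (gammaPart c) ((Real.log |c.im| / 2 : ℝ) : ℂ)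
    rw [norm_real, Real.norm_of_nonneg (by rw [cim]; positivity), cim] at g3
    rw [cim] at g1
    exact (norm_add_le _ _).trans (by linarith)
  have hball : ∀ w ∈ ball (0 : ℂ) (3 / 2), 1 / 2 < (c + w).re := fun w hw => by
    have := abs_lt.1 ((abs_re_le_norm w).trans_lt (by simpa using hw))
    rw [add_re, cre]
    linarith
  have es : s - c = ((s.re - 2 : ℝ) : ℂ) := by
    apply Complex.ext <;> simp [hc, y]
  have er : ‖s - c‖ = 2 - s.re := by
    rw [es, norm_real, Real.norm_eq_abs, abs_of_nonpos (by linarith)]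
    ring
  have hHs : ‖logDeriv xi s‖ ≤ (3 + 3 * ‖logDeriv xi c‖) / ε := by
    -- `-xi' / xi` has nonpositive real part on the disc of radius `3/2` about `2 + iy`, so any
    -- positive `M` serves.
    have := borelCaratheodory (f := fun w => -logDeriv xi (c + w)) (M := 1) (R := 3 / 2)
      (z := s - c) one_pos (fun w hw => ?_) (fun w hw => ?_) (by norm_num)
      (by rw [mem_ball_zero_iff, er]; linarith)
    · simp only [norm_neg, add_sub_cancel, add_zero, er] at this
      refine this.trans ?_
      have hn := norm_nonneg (logDeriv xi c)
      rw [← add_div, div_le_div_iff₀ (by linarith) hε]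
      have t1 : 2 * 1 * (2 - s.re) + ‖logDeriv xi c‖ * (3 / 2 + (2 - s.re)) ≤
          3 + 3 * ‖logDeriv xi c‖ := by nlinarith
      calc _ ≤ (3 + 3 * ‖logDeriv xi c‖) * ε := by gcongr
        _ ≤ _ := by gcongr; linarith
    · have h5 := xi_ne_zero hRH (hball w hw)
      have h6 : DifferentiableAt ℂ (logDeriv xi) (c + w) :=
        ((differentiable_xi.analyticAt _).deriv.differentiableAt).div (differentiable_xi _) h5
      have h7 : DifferentiableAt ℂ (fun w => logDeriv xi (c + w)) w := h6.comp w (by fun_prop)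
      exact h7.neg.differentiableWithinAt
    · have := re_logDeriv_xi_nonneg hRH (hball w hw)
      simp only [mem_ofPred_eq, neg_re]
      linarith
  have e := logDeriv_xi_eq (s := s) (by linarith) (hne s h3)
    (riemannZeta_ne_zero_of_half_lt_re hRH (by linarith) (hne s h3))
  have g1 := norm_gammaPart_sub_le (s := s) (by linarith) (by linarith) h3
  have g3 := norm_le_norm_sub_add (gammaPart s) ((Real.log |s.im| / 2 : ℝ) : ℂ)
  rw [norm_real, Real.norm_of_nonneg (by positivity)] at g3
  have e' : logDeriv riemannZeta s = logDeriv xi s - gammaPart s := by rw [e]; ring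
  rw [e']
  refine (norm_sub_le _ _).trans ?_
  have g4 : ‖gammaPart s‖ ≤ (Real.log |y| / 2 + 25) / ε := by
    rw [le_div_iff₀ hε]
    have : ‖gammaPart s‖ ≤ Real.log |y| / 2 + 25 := by linarith
    nlinarith [norm_nonneg (gammaPart s)]
  calc _ ≤ (3 + 3 * (B + Real.log |y| / 2 + 25)) / ε + (Real.log |y| / 2 + 25) / ε := by
        refine add_le_add (hHs.trans ?_) g4
        gcongr
    _ = _ := by ring

/-! ### From the logarithmic derivative to the size of zeta -/

theorem hasDerivAt_log_norm {f : ℝ → ℂ} {f' : ℂ} {x : ℝ} (hf : HasDerivAt f f' x) (h0 : f x ≠ 0) :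
    HasDerivAt (fun r => Real.log ‖f r‖) (f' / f x).re x := by
  have hn : ‖f x‖ ^ 2 ≠ 0 := pow_ne_zero 2 (norm_ne_zero_iff.2 h0)
  have h1 := (hf.norm_sq.log hn).div_const 2
  have e : (fun r => Real.log (‖f r‖ ^ 2) / 2) = fun r => Real.log ‖f r‖ := by
    ext r
    rw [Real.log_pow]
    push_cast
    ring
  rw [e] at h1
  refine h1.congr_deriv ?_
  rw [Complex.inner, div_eq_mul_inv f', inv_def, ← mul_assoc, re_mul_ofReal, normSq_eq_norm_sq,
    mul_comm f']
  field_simp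

theorem differentiableAt_logDeriv_riemannZeta (hRH : RiemannHypothesis) {s : ℂ} (hs : 1 / 2 < s.re)
    (hs1 : s ≠ 1) :
    DifferentiableAt ℂ (logDeriv riemannZeta) s :=
  ((analyticOn_riemannZeta s hs1).deriv.differentiableAt).div (differentiableAt_riemannZeta hs1)
    (riemannZeta_ne_zero_of_half_lt_re hRH hs hs1)

theorem integral_re_logDeriv_riemannZeta (hRH : RiemannHypothesis) {s : ℂ} (hs : 1 / 2 < s.re)
    (hs0 : s.im ≠ 0) {A : ℝ}
    (hA : 0 ≤ A) : ∫ u : ℝ in (0 : ℝ)..A, (logDeriv riemannZeta (s + u)).re =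
      Real.log ‖riemannZeta (s + A)‖ - Real.log ‖riemannZeta s‖ := by
  have hre : ∀ u ∈ uIcc 0 A, 1 / 2 < (s + (u : ℝ)).re := fun u hu => by
    rw [uIcc_of_le hA] at hu
    simp
    linarith [hu.1]
  have hne : ∀ u : ℝ, s + u ≠ 1 := fun u h => hs0 (by simpa using congrArg im h)
  have hd : ∀ u ∈ uIcc 0 A, HasDerivAt (fun u : ℝ => Real.log ‖riemannZeta (s + u)‖)
      (logDeriv riemannZeta (s + u)).re u := fun u hu => by
    have h1 : HasDerivAt (fun z : ℂ => riemannZeta (s + z)) (deriv riemannZeta (s + u)) u :=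
      (differentiableAt_riemannZeta (hne u)).hasDerivAt.comp_const_add s u
    exact hasDerivAt_log_norm h1.comp_ofReal
      (riemannZeta_ne_zero_of_half_lt_re hRH (hre u hu) (hne u))
  have hc : ContinuousOn (fun u : ℝ => (logDeriv riemannZeta (s + u)).re) (uIcc 0 A) :=
    fun u hu => by
      have h1 : ContinuousAt (fun u : ℝ => logDeriv riemannZeta (s + u)) u :=
        ContinuousAt.comp (f := fun u : ℝ => s + (u : ℂ)) (g := logDeriv riemannZeta)
          (differentiableAt_logDeriv_riemannZeta hRH (hre u hu) (hne u)).continuousAt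
          (by fun_prop)
      exact (continuous_re.continuousAt.comp h1).continuousWithinAt
  rw [intervalIntegral.integral_eq_sub_of_hasDerivAt hd hc.intervalIntegrable]
  simp

/-- Zeros on the critical line forbid integrating from it directly. The one-sided bound is
integrated from `1/2 + η` to `1/2 + ε`, then `η → 0` by continuity of zeta. -/
theorem norm_riemannZeta_half_le (hRH : RiemannHypothesis) {t ε : ℝ} (ht : 2 ≤ |t|) (hε : 0 < ε)
    (hε1 : ε ≤ 1) :
    ‖riemannZeta (1 / 2 + I * t)‖ ≤
      ‖riemannZeta ((1 / 2 + ε : ℝ) + I * t)‖ * Real.exp (ε * (Real.log |t| / 2 + 25)) := by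
  set L := Real.log |t| / 2 + 25
  have hL : 0 ≤ L := by
    have := Real.log_nonneg (show 1 ≤ |t| by linarith)
    positivity
  have ht0 : t ≠ 0 := by rintro rfl; norm_num at ht
  have key : ∀ η ∈ Ioo 0 ε, ‖riemannZeta ((1 / 2 + η : ℝ) + I * t)‖ ≤
      ‖riemannZeta ((1 / 2 + ε : ℝ) + I * t)‖ * Real.exp (ε * L) := by
    intro η hη
    set s : ℂ := (1 / 2 + η : ℝ) + I * t with hs
    have sre : s.re = 1 / 2 + η := by simp [hs]
    have sim : s.im = t := by simp [hs]
    have hse : s + (ε - η : ℝ) = (1 / 2 + ε : ℝ) + I * t := by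
      rw [hs]; push_cast; ring
    have h1 := integral_re_logDeriv_riemannZeta hRH (s := s) (by rw [sre]; linarith [hη.1])
      (by rwa [sim]) (sub_nonneg.2 hη.2.le)
    have h2 : -((ε - η) * L) ≤ ∫ u : ℝ in (0 : ℝ)..(ε - η), (logDeriv riemannZeta (s + u)).re := by
      have h3 : ∫ u : ℝ in (0 : ℝ)..(ε - η), -L = -((ε - η) * L) := by simp
      rw [← h3]
      by_cases hi : IntervalIntegrable (fun u : ℝ => (logDeriv riemannZeta (s + u)).re) volume 0
        (ε - η)
      · refine intervalIntegral.integral_mono_on (sub_nonneg.2 hη.2.le) (by simp) hi fun u hu => ?_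
        have := neg_le_re_logDeriv_riemannZeta hRH (s := s + u)
          (by simp [sre]; linarith [hη.1, hu.1]) (by simp [sre]; linarith [hη.1, hu.2])
          (by simpa [sim] using ht)
        have e : (s + u).im = t := by simp [sim]
        rwa [e] at this
      · rw [h3, intervalIntegral.integral_undef hi]
        have := mul_nonneg (sub_nonneg.2 hη.2.le) hL
        linarith
    rw [h1, hse] at h2
    have n1 : 0 < ‖riemannZeta s‖ := norm_pos_iff.2 (riemannZeta_ne_zero_of_half_lt_re hRH
      (by rw [sre]; linarith [hη.1]) fun h => ht0 (by rw [← sim, h, one_im]))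
    have n2 : 0 < ‖riemannZeta ((1 / 2 + ε : ℝ) + I * t)‖ :=
      norm_pos_iff.2 (riemannZeta_ne_zero_of_half_lt_re hRH (by simp; linarith)
        fun h => ht0 (by simpa using congrArg im h))
    rw [← Real.exp_log n1]
    conv_rhs => rw [← Real.exp_log n2]
    rw [← Real.exp_add]
    gcongr
    nlinarith [mul_nonneg hη.1.le hL]
  have hlim : Tendsto (fun η : ℝ => ‖riemannZeta ((1 / 2 + η : ℝ) + I * t)‖) (𝓝[>] 0)
      (𝓝 ‖riemannZeta (1 / 2 + I * t)‖) := by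
    have h1 : ContinuousAt (fun η : ℝ => riemannZeta ((1 / 2 + η : ℝ) + I * t)) 0 := by
      refine ContinuousAt.comp (f := fun η : ℝ => (((1 / 2 + η : ℝ) : ℂ) + I * t))
        (g := riemannZeta) ?_ (by fun_prop)
      exact (differentiableAt_riemannZeta
        fun h => ht0 (by simpa using congrArg im h)).continuousAt
    have h2 := h1.norm.tendsto
    norm_num at h2
    norm_num
    exact h2.mono_left nhdsWithin_le_nhds
  refine le_of_tendsto hlim ?_
  filter_upwards [Ioo_mem_nhdsGT hε] with η hη using key η hη

/-! ### Choice of parameters and asymptotics -/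

/-- The upper bound for `log ‖ζ(1/2 + it)‖` in terms of `T = log t`, with a parameter `d`. -/
noncomputable def logZetaBound (d C B K T : ℝ) : ℝ :=
  d / Real.log T * (T / 2 + 25) + Real.log K +
    (1 + lambdaZero) * (T / 2 + 26) / ((2 - 10 * d) * Real.log T) +
    (lambdaZero / ((2 - 10 * d) * Real.log T)) ^ 2 / 2 * (T / 2 + 26 +
      2 * sideError (1 / 2 + 2 * d) T (1 / 2 + d) ((C + 2 * (T + 1)) / (d / Real.log T)) B) +
    (B + (1 / 2 + d) * (2 * Real.exp ((2 - 10 * d) * Real.log T * (1 / 2 + 2 * d)) *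
      sideError (1 / 2 + 2 * d) T (1 / 2 + d) ((C + 2 * (T + 1)) / (d / Real.log T)) B +
      (T / 2 + 26) * sideError (1 / 2 + 2 * d) T (1 / 2 + d) 1
        (Real.exp (-((2 - 10 * d) * Real.log T * (1 / 2 + 2 * d)))))) /
      ((2 - 10 * d) * Real.log T)

theorem tendsto_logZetaBound {d : ℝ} (hd : 0 < d) (hd' : d ≤ 1 / 20) (C B K : ℝ) :
    Tendsto (fun T => logZetaBound d C B K T * (Real.log T / T)) atTop
      (𝓝 (d / 2 + (1 + lambdaZero) / (2 * (2 - 10 * d)))) := by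
  set p := 2 - 10 * d with hp
  have hp0 : 0 < p := by rw [hp]; linarith
  set X := 1 / 2 + 2 * d with hX
  set A := 1 / 2 + d with hA
  have hXA : X - A = d := by rw [hX, hA]; ring
  have h1 : Tendsto (fun T : ℝ => Real.log T / T) atTop (𝓝 0) := by
    simpa using Real.tendsto_pow_log_div_mul_add_atTop 1 0 1 one_ne_zero
  have h2 : Tendsto (fun T : ℝ => T⁻¹) atTop (𝓝 0) := tendsto_inv_atTop_zero
  have h3 : Tendsto (fun T : ℝ => (Real.log T)⁻¹) atTop (𝓝 0) :=
    tendsto_inv_atTop_zero.comp Real.tendsto_log_atTop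
  have hexp : ∀ c : ℝ, c < 0 → Tendsto (fun T : ℝ => Real.exp (c * Real.log T)) atTop (𝓝 0) :=
    fun c hc => Real.tendsto_exp_atBot.comp (Real.tendsto_log_atTop.const_mul_atTop_of_neg hc)
  -- `p * X - 1 = -d - 20 * d ^ 2 < 0`: this makes `e^{lX} = T^{pX}` of smaller order than `T`, and
  -- is why `l` stays below `2 log T`.
  have h4 := hexp (p * X - 1) (by rw [hp, hX]; nlinarith)
  have h5 := hexp (-(p * X)) (by have : 0 < X := by rw [hX]; linarith
                                 have := mul_pos hp0 this
                                 linarith)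
  have hE : Tendsto (fun T : ℝ => 2 * X / d * ((C + 2) * T⁻¹ + 2) * (Real.log T / T) +
      B * (Real.pi / d)) atTop (𝓝 (2 * X / d * ((C + 2) * 0 + 2) * 0 + B * (Real.pi / d))) :=
    ((((h2.const_mul _).add_const _).const_mul _).mul h1).add_const _
  have hE4 : Tendsto (fun T : ℝ => 2 * X * (T⁻¹ * T⁻¹) + Real.exp (-(p * X) * Real.log T) *
      (Real.pi / d)) atTop (𝓝 (2 * X * (0 * 0) + 0 * (Real.pi / d))) :=
    ((h2.mul h2).const_mul _).add (h5.mul_const _)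
  have hL : Tendsto (fun T : ℝ => 1 / 2 + 26 * T⁻¹) atTop (𝓝 (1 / 2 + 26 * 0)) :=
    (h2.const_mul _).const_add _
  have hL' : Tendsto (fun T : ℝ => 1 / 2 + 25 * T⁻¹) atTop (𝓝 (1 / 2 + 25 * 0)) :=
    (h2.const_mul _).const_add _
  have H := (((((hL'.const_mul d).add (h1.const_mul (Real.log K))).add
    (hL.const_mul ((1 + lambdaZero) / p))).add
    ((h3.mul (hL.add ((h2.mul hE).const_mul 2))).const_mul (lambdaZero ^ 2 / (2 * p ^ 2)))).add
    (((h2.const_mul B).add ((((h4.mul hE).const_mul 2).add (hL.mul hE4)).const_mul A)).const_mul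
      (1 / p)))
  have e0 : d / 2 + (1 + lambdaZero) / (2 * p) = d * (1 / 2 + 25 * 0) + Real.log K * 0 +
      (1 + lambdaZero) / p * (1 / 2 + 26 * 0) +
      lambdaZero ^ 2 / (2 * p ^ 2) * (0 * (1 / 2 + 26 * 0 +
        2 * (0 * (2 * X / d * ((C + 2) * 0 + 2) * 0 + B * (Real.pi / d))))) +
      1 / p * (B * 0 + A * (2 * (0 * (2 * X / d * ((C + 2) * 0 + 2) * 0 + B * (Real.pi / d))) +
        (1 / 2 + 26 * 0) * (2 * X * (0 * 0) + 0 * (Real.pi / d)))) := by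
    field_simp
    ring
  rw [e0]
  refine H.congr' ?_
  filter_upwards [eventually_gt_atTop 1] with T hT
  have hl : 0 < Real.log T := Real.log_pos hT
  have hT0 : 0 < T := by linarith
  have ex : Real.exp (p * Real.log T * X) = Real.exp ((p * X - 1) * Real.log T) * T := by
    calc Real.exp (p * Real.log T * X) = Real.exp ((p * X - 1) * Real.log T + Real.log T) := by
          ring_nf
      _ = _ := by rw [Real.exp_add, Real.exp_log hT0]
  have eE : sideError X T A ((C + 2 * (T + 1)) / (d / Real.log T)) B =
      2 * X / d * ((C + 2) * T⁻¹ + 2) * (Real.log T / T) + B * (Real.pi / d) := by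
    rw [sideError, hXA]
    field_simp
    ring
  have eE4 : sideError X T A 1 (Real.exp (-(p * Real.log T * X))) =
      2 * X * (T⁻¹ * T⁻¹) + Real.exp (-(p * X) * Real.log T) * (Real.pi / d) := by
    rw [sideError, hXA, show -(p * Real.log T * X) = -(p * X) * Real.log T by ring]
    field_simp
  rw [logZetaBound]
  simp only [← hp, ← hX, ← hA]
  rw [eE, eE4, ex]
  generalize 2 * X / d * ((C + 2) * T⁻¹ + 2) * (Real.log T / T) + B * (Real.pi / d) = E
  generalize 2 * X * (T⁻¹ * T⁻¹) + Real.exp (-(p * X) * Real.log T) * (Real.pi / d) = E4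
  generalize Real.exp ((p * X - 1) * Real.log T) = W
  clear_value p X A
  field_simp

theorem exists_norm_riemannZeta_half_le (hRH : RiemannHypothesis) {d : ℝ} (hd : 0 < d)
    (hd' : d ≤ 1 / 20) : ∃ C B K : ℝ, ∀ᶠ t : ℝ in atTop,
      ‖riemannZeta (1 / 2 + I * t)‖ ≤ Real.exp (logZetaBound d C B K (Real.log t)) := by
  obtain ⟨C, hC0, hC⟩ := exists_norm_logDeriv_riemannZeta_le_div hRH
  obtain ⟨B, hB0, hB⟩ := exists_norm_logDeriv_riemannZeta_le (σ := 1 + d) (by linarith)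
  obtain ⟨K, hK1, hK⟩ := exists_norm_riemannZeta_le (σ := 1 + d) (by linarith)
  refine ⟨C, B, K, ?_⟩
  obtain ⟨⟨hm, hm'⟩, -, -, hm2⟩ := lambdaZero_spec
  have hlog2 : Tendsto (fun t => Real.log (Real.log t)) atTop atTop :=
    Real.tendsto_log_atTop.comp Real.tendsto_log_atTop
  -- Keeps the box of half-height `log t` about `t` between ordinates `t/2` and `3t/2 < e * t`.
  have hlin : ∀ᶠ t : ℝ in atTop, Real.log t ≤ t / 2 := by
    have := (Real.isLittleO_log_id_atTop).bound (show (0 : ℝ) < 1 / 2 by norm_num)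
    filter_upwards [this, eventually_gt_atTop 0] with t h1 h2
    simp only [id, Real.norm_eq_abs, abs_of_pos h2] at h1
    linarith [le_abs_self (Real.log t)]
  filter_upwards [hlin, eventually_ge_atTop 4, Real.tendsto_log_atTop.eventually_ge_atTop 1,
    hlog2.eventually_ge_atTop 1] with t htT ht4 hT1 hS1
  set T := Real.log t with hT
  set S := Real.log T with hS
  -- Small enough that returning to the critical line costs only about `(d / 2) T / S`, and large
  -- enough that `1 / ε` is merely `S / d`.
  set ε := d / S with hε
  have ht0 : 0 < t := by linarith
  have hS0 : 0 < S := by linarith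
  have hε0 : 0 < ε := div_pos hd hS0
  have hεd : ε ≤ d := div_le_self hd.le hS1
  set l := (2 - 10 * d) * S with hl
  have hl1 : 1 ≤ l := by nlinarith
  have hml : lambdaZero / l ≤ 1 / 2 + d := (div_le_self hm.le hl1).trans (by linarith)
  set s : ℂ := (1 / 2 + ε : ℝ) + I * t with hs
  have sre : s.re = 1 / 2 + ε := by simp [hs]
  have sim : s.im = t := by simp [hs]
  have him : ∀ w ∈ boxSet (1 / 2 + 2 * d) T, 2 ≤ |(s + w).im| ∧
      Real.log |(s + w).im| ≤ T + 1 := by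
    rintro w ⟨-, h1, h2⟩
    rw [add_im, sim, abs_of_pos (by linarith)]
    refine ⟨by linarith, ?_⟩
    rw [Real.log_le_iff_le_exp (by linarith), Real.exp_add, hT, Real.exp_log ht0]
    nlinarith [Real.exp_one_gt_d9]
  -- The abscissa `A = 1/2 + d` brings `s + w` to real part at least `1 + d`, so `B` and `K` do not
  -- depend on `t`. The gap `X - A = d` keeps the right side bounded.
  have hbox : BoxBounds (fun w => logDeriv riemannZeta (s + w)) {w | -ε < w.re ∧ -t < w.im}
      (1 / 2 + 2 * d) T (1 / 2 + d) (T / 2 + 26) ((C + 2 * (T + 1)) / ε) B :=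
    { isOpen := (isOpen_lt continuous_const continuous_re).inter
        (isOpen_lt continuous_const continuous_im)
      subset := fun w hw => ⟨by linarith [hw.1.1], by linarith [hw.2.1]⟩
      diff := fun w hw => by
        refine DifferentiableAt.differentiableWithinAt ?_
        refine DifferentiableAt.comp (f := fun w => s + w) (g := logDeriv riemannZeta) w
          (differentiableAt_logDeriv_riemannZeta hRH ?_ fun h => ?_) (by fun_prop)
        · rw [add_re, sre]
          linarith [hw.1]
        · have h1 := congrArg im h
          rw [add_im, sim, one_im] at h1
          linarith [hw.2]
      A_pos := by linarith
      A_lt := by linarith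
      Y_ge := hT1
      L_nonneg := by linarith
      M_nonneg := by positivity
      B_nonneg := hB0
      norm_le_M := fun w hw _ => by
        obtain ⟨h1, h2⟩ := him w hw
        refine (hC ε (s + w) hε0 (by linarith) (by rw [add_re, sre]; linarith [hw.1.1])
          (by rw [add_re, sre]; linarith [hw.1.2]) h1).trans ?_
        gcongr
      norm_le_B := fun w _ hA => hB _ (by rw [add_re, sre]; linarith)
      neg_L_le := fun w hw => by
        obtain ⟨h1, h2⟩ := him w hw
        have := neg_le_re_logDeriv_riemannZeta hRH (s := s + w)
          (by rw [add_re, sre]; linarith [hw.1.1]) (by rw [add_re, sre]; linarith [hw.1.2]) h1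
        linarith }
  have h1 := hbox.integral_re_ge_of_exp_eq hm hm' (by linarith) hml
  rw [integral_re_logDeriv_riemannZeta hRH (by rw [sre]; linarith) (by rw [sim]; exact ht0.ne')
    (by linarith)] at h1
  have hne : ∀ u : ℝ, 0 ≤ u → riemannZeta (s + u) ≠ 0 := fun u hu =>
    riemannZeta_ne_zero_of_half_lt_re hRH (by rw [add_re, sre, ofReal_re]; linarith) fun h => by
      have := congrArg im h
      rw [add_im, sim, ofReal_im, one_im] at this
      linarith
  have h2 : Real.log ‖riemannZeta (s + (1 / 2 + d : ℝ))‖ ≤ Real.log K :=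
    Real.log_le_log (norm_pos_iff.2 (hne _ (by linarith)))
      (hK _ (by rw [add_re, sre, ofReal_re]; linarith))
  have h3 := norm_riemannZeta_half_le hRH (t := t) (by rw [abs_of_pos ht0]; linarith) hε0
    (by linarith)
  rw [abs_of_pos ht0, ← hT, ← hs, ← Real.exp_log (norm_pos_iff.2 (by simpa using hne 0 le_rfl) :
    0 < ‖riemannZeta s‖), ← Real.exp_add] at h3
  refine h3.trans (Real.exp_le_exp.2 ?_)
  rw [logZetaBound]
  simp only [← hS, ← hε, ← hl]
  linarith

/-- The limiting constant tends to `(1 + λ₀) / 4` as `d → 0`, so some fixed `d` brings it below the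
prescribed excess. -/
theorem eventually_norm_riemannZeta_half_le (hRH : RiemannHypothesis) {κ : ℝ} (hκ : 0 < κ) :
    ∀ᶠ t : ℝ in atTop, ‖riemannZeta (1 / 2 + I * t)‖ ≤
      Real.exp (((1 + lambdaZero) / 4 + κ) * (Real.log t / Real.log (Real.log t))) := by
  obtain ⟨d, hd, hd', hlt⟩ : ∃ d : ℝ, 0 < d ∧ d ≤ 1 / 20 ∧
      d / 2 + (1 + lambdaZero) / (2 * (2 - 10 * d)) < (1 + lambdaZero) / 4 + κ := by
    have hc : ContinuousAt (fun d : ℝ => d / 2 + (1 + lambdaZero) / (2 * (2 - 10 * d))) 0 := by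
      refine ContinuousAt.add (by fun_prop) (ContinuousAt.div (by fun_prop) (by fun_prop) ?_)
      norm_num
    have h1 := hc.tendsto.mono_left (nhdsWithin_le_nhds (s := Ioi 0))
    have h2 := h1.eventually_lt_const (u := (1 + lambdaZero) / 4 + κ) (by norm_num; exact hκ)
    obtain ⟨d, h3, h4⟩ := (h2.and (Ioc_mem_nhdsGT (show (0 : ℝ) < 1 / 20 by norm_num))).exists
    exact ⟨d, h4.1, h4.2, h3⟩
  obtain ⟨C, B, K, h⟩ := exists_norm_riemannZeta_half_le hRH hd hd'
  have h1 := (tendsto_logZetaBound hd hd' C B K).comp Real.tendsto_log_atTop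
  filter_upwards [h, h1.eventually_lt_const hlt, Real.tendsto_log_atTop.eventually_gt_atTop 1]
    with t h2 h3 h4
  refine h2.trans (Real.exp_le_exp.2 ?_)
  have h5 := Real.log_pos h4
  have h6 : 0 < Real.log t / Real.log (Real.log t) := div_pos (by linarith) h5
  refine le_trans (le_of_eq ?_) (mul_le_mul_of_nonneg_right h3.le h6.le)
  simp only [Function.comp]
  field_simp

end

theorem corollaryC (hRH : RiemannHypothesis) :
    ∃ δ : ℝ → ℝ, Tendsto δ atTop (𝓝 0) ∧
      ∀ᶠ t : ℝ in atTop,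
        ‖riemannZeta (1 / 2 + Complex.I * (t : ℂ))‖ ≤
            Real.exp (((1 + lambdaZero) / 4 + δ t) * (Real.log t / Real.log (Real.log t))) ∧
          Real.exp (((1 + lambdaZero) / 4 + δ t) * (Real.log t / Real.log (Real.log t))) ≤
            Real.exp (3 / 8 * (Real.log t / Real.log (Real.log t))) := by
  have hpos : ∀ᶠ t : ℝ in atTop, 0 < Real.log t / Real.log (Real.log t) := by
    filter_upwards [Real.tendsto_log_atTop.eventually_gt_atTop 1] with t ht
    exact div_pos (by linarith) (Real.log_pos ht)
  -- The smallest nonnegative excess that makes the first bound hold; the bounds for each fixed `κ`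
  -- say that it tends to zero.
  set δ : ℝ → ℝ := fun t => max 0 (Real.log ‖riemannZeta (1 / 2 + Complex.I * t)‖ /
    (Real.log t / Real.log (Real.log t)) - (1 + lambdaZero) / 4) with hδ
  have hlim : Tendsto δ atTop (𝓝 0) := by
    refine tendsto_order.2 ⟨fun a ha => .of_forall fun t => ha.trans_le (le_max_left _ _),
      fun a ha => ?_⟩
    filter_upwards [hpos, eventually_norm_riemannZeta_half_le hRH (half_pos ha)] with t h1 h2
    refine max_lt ha ?_
    rcases eq_or_ne (riemannZeta (1 / 2 + Complex.I * t)) 0 with h0 | h0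
    -- At a zero of zeta the convention `log 0 = 0` makes the second entry of the maximum negative.
    · rw [h0, norm_zero, Real.log_zero, zero_div]
      linarith [lambdaZero_spec.1.1]
    · rw [← Real.log_le_iff_le_exp (norm_pos_iff.2 h0), ← div_le_iff₀ h1] at h2
      linarith
  refine ⟨δ, hlim, ?_⟩
  -- `1.4913 / 4 < 0.374`, which leaves `0.001` below `3/8` for `δ`.
  have hlam : (1 + lambdaZero) / 4 < 0.374 := by
    have := lambdaZero_spec.2.2.2
    norm_num at this ⊢
    linarith
  filter_upwards [hpos, hlim.eventually_lt_const (show (0 : ℝ) < 0.001 by norm_num)] with t h1 h2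
  constructor
  · rcases eq_or_ne (riemannZeta (1 / 2 + Complex.I * t)) 0 with h0 | h0
    · rw [h0, norm_zero]
      positivity
    · rw [← Real.log_le_iff_le_exp (norm_pos_iff.2 h0), ← div_le_iff₀ h1]
      have h3 : Real.log ‖riemannZeta (1 / 2 + Complex.I * t)‖ /
        (Real.log t / Real.log (Real.log t)) - (1 + lambdaZero) / 4 ≤ δ t := le_max_right _ _
      linarith
  · gcongr
    norm_num at hlam h2 ⊢
    linarith
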